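/- Let $m\ge 1$ be an odd integer. Let $\mathbb R_{0,m}$ be the real Clifford algebra with generators $e_1,\dots,e_m$, where $e_j^2=-1$ and $e_je_k+e_ke_j=0$ for $j\neq k$. Let $\overline{a}$ denote Clifford conjugation, and let $|a|=(\sum_A a_A^2)^{1/2}$ for $a=\sum_A a_Ae_A$, where $e_A=e_{j_1}\cdots e_{j_k}$ for $A=\{j_1<\dots<j_k\}\subset\{1,\dots,m\}$. Identify $(x_0,x_1,\dots,x_m)\in\mathbb R^{m+1}$ with $x=x_0+\underline x$, where $\underline x=\sum_{j=1}^m x_je_j$, and put $r=|\underline x|$ and $\underline\omega=\underline x/r$. Let $\partial_x=\partial_{x_0}+\sum_{j=1}^m e_j\partial_{x_j}$ be the generalized Cauchy–Riemann operator and $\Delta_x=\sum_{j=0}^m\partial_{x_j}^2$. Write $\exp(z^2/2)/z=u(x,y)+i\,v(x,y)$ for $z=x+iy\ne0$, with $u,v$ real-valued, and define $$\mathsf{Ft}\left[\exp(z^2/2)/z,1\right](x)=\Delta_x^{\frac{m-1}{2}}\bigl[u(x_0,r)+\underline\omega\,v(x_0,r)\bigr],\qquad x\neq0,$$ where $\underline\omega\,v(x_0,r)$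 is read as $0$ at the points with $\underline x=0$, $x_0\ne0$ (there $v(x_0,0)=0$). (1) There is a continuously differentiable function $\mathsf M:\mathbb R^{m+1}\to\mathbb R_{0,m}$ with $\partial_x\mathsf M=\mathsf M\partial_x=0$ on all of $\mathbb R^{m+1}$ (an entire two-sided monogenic function) such that $$\mathsf{Ft}\left[\exp(z^2/2)/z,1\right](x)=(-1)^{\frac{m-1}{2}}\bigl((m-1)!!\bigr)^2\left(\frac{\overline x}{|x|^{m+1}}+\mathsf M(x)\right)\qquad\text{for all }x\in\mathbb R^{m+1}\setminus\{0\}.$$ (2) Up to a nonzero real multiplicative constant, $\mathsf{Ft}[\exp(z^2/2)/z,1]$ is a fundamental solution of $\partial_x$: it is locally integrable on $\mathbb R^{m+1}$, and for some real $c\neq0$ the function $E=c\,\mathsf{Ft}[\exp(z^2/2)/z,1]$ satisfies $\partial_xE=E\,\partial_x=\delta_0$ in the sense of distributions. (3) For all $K,R>0$ there is a constant $C>0$ such that for all $x$ with $|x_0|\le K$ and $|\underline x|\ge R$, $$\bigl|\mathsf{Ft}\left[\exp(z^2/2)/z,1\right](x)\bigr|\le C\exp\bigl(-|\underline x|^2/2\bigr).$$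 -/

import Mathlib

open scoped ContDiff

noncomputable section

namespace Clifford

/-! ### The real Clifford algebra `ℝ_{0,m}` with its norm -/

/-- The quadratic form `v ↦ -|v|²` on Euclidean `ℝ^m`. -/
def negSq (m : ℕ) : QuadraticForm ℝ (EuclideanSpace ℝ (Fin m)) :=
  -LinearMap.BilinMap.toQuadraticMap (innerₗ (EuclideanSpace ℝ (Fin m)))

theorem negSq_apply (m : ℕ) (v : EuclideanSpace ℝ (Fin m)) : negSq m v = -‖v‖ ^ 2 := by
  simp [negSq]

/-- The real Clifford algebra `ℝ_{0,m}`, in which `v * v = -|v|²` for every vector `v ∈ ℝ^m`. -/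
abbrev Cl (m : ℕ) : Type := CliffordAlgebra (negSq m)

/-- The inclusion `ℝ^m → ℝ_{0,m}` of the vectors, `(x₁, …, x_m) ↦ ∑ x_j e_j`. -/
abbrev vec (m : ℕ) : EuclideanSpace ℝ (Fin m) →ₗ[ℝ] Cl m := CliffordAlgebra.ι (negSq m)

/-- The generators `e_1, …, e_m`. -/
def e (m : ℕ) (j : Fin m) : Cl m := vec m (EuclideanSpace.single j 1)

/-- The basis `(e_A)` of `ℝ_{0,m}`, indexed by the subsets `A` of `{1, …, m}`, obtained from the
canonical linear isomorphism with the exterior algebra; see `basis_apply`. -/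
def basis (m : ℕ) : Module.Basis (Finset (Fin m)) ℝ (Cl m) :=
  (EuclideanSpace.basisFun (Fin m) ℝ).toBasis.ExteriorAlgebra.map
    (CliffordAlgebra.equivExterior (negSq m)).symm

/-- In Clifford and exterior algebras of forms that differ by an orthogonal form, products of
distinct orthogonal generators correspond. -/
theorem changeForm_prod {m : ℕ} {Q Q' : QuadraticForm ℝ (EuclideanSpace ℝ (Fin m))}
    {B : LinearMap.BilinForm ℝ (EuclideanSpace ℝ (Fin m))} (h : B.toQuadraticMap = Q' - Q)
    (hB : ∀ i j : Fin m, i ≠ j →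
      B (EuclideanSpace.single i 1) (EuclideanSpace.single j 1) = 0)
    (l : List (Fin m)) (hl : l.Nodup) :
    CliffordAlgebra.changeForm h
        (l.map fun j => CliffordAlgebra.ι Q (EuclideanSpace.single j 1)).prod =
      (l.map fun j => CliffordAlgebra.ι Q' (EuclideanSpace.single j 1)).prod := by
  have key : ∀ (i : Fin m) (l : List (Fin m)), i ∉ l →
      CliffordAlgebra.contractLeft (B (EuclideanSpace.single i 1))
        (l.map fun j => CliffordAlgebra.ι Q' (EuclideanSpace.single j 1)).prod = 0 := by
    intro i l
    induction l with
    | nil => intro _; simp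
    | cons a l ih =>
      intro hi
      rw [List.mem_cons, not_or] at hi
      rw [List.map_cons, List.prod_cons, CliffordAlgebra.contractLeft_ι_mul, ih hi.2,
        hB i a hi.1]
      simp
  induction l with
  | nil => simp
  | cons a l ih =>
    rw [List.nodup_cons] at hl
    rw [List.map_cons, List.prod_cons, CliffordAlgebra.changeForm_ι_mul, ih hl.2,
      key a l hl.1, sub_zero, List.map_cons, List.prod_cons]

/-- `e_A = e_{j_1} ⋯ e_{j_k}` for `A = {j_1 < ⋯ < j_k}`. -/
theorem basis_apply (m : ℕ) (A : Finset (Fin m)) :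
    basis m A = ((A.sort (· ≤ ·)).map (e m)).prod := by
  rw [basis, Module.Basis.map_apply, LinearEquiv.symm_apply_eq, CliffordAlgebra.equivExterior,
    CliffordAlgebra.changeFormEquiv_apply]
  unfold e vec
  rw [changeForm_prod]
  · rw [ExteriorAlgebra.basis_apply_ofCard (n := A.card) _ rfl,
      ← Finset.listMap_orderEmbOfFin_finRange A rfl, List.map_map]
    simp [ExteriorAlgebra.ιMulti_family, ExteriorAlgebra.ιMulti_apply, List.ofFn_eq_map,
      Function.comp_def]
    rfl
  · intro i j hij
    simp [negSq, QuadraticMap.associated_apply, inner_add_right,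
      EuclideanSpace.inner_single_left, hij, hij.symm]
  · exact A.sort_nodup _

/-- The coordinates `a ↦ (a_A)_A` with respect to the basis `(e_A)`. -/
def coords (m : ℕ) : Cl m →ₗ[ℝ] EuclideanSpace ℝ (Finset (Fin m)) :=
  ((basis m).equivFun.trans (WithLp.linearEquiv 2 ℝ (Finset (Fin m) → ℝ)).symm).toLinearMap

theorem coords_injective (m : ℕ) : Function.Injective (coords m) :=
  ((basis m).equivFun.trans (WithLp.linearEquiv 2 ℝ (Finset (Fin m) → ℝ)).symm).injective

/-- The norm `|a| = (∑_A a_A²)^{1/2}` on `ℝ_{0,m}`; see `norm_sq_eq`. -/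
instance instNormedAddCommGroup (m : ℕ) : NormedAddCommGroup (Cl m) :=
  NormedAddCommGroup.induced (Cl m) (EuclideanSpace ℝ (Finset (Fin m))) (coords m)
    (coords_injective m)

instance instNormedSpace (m : ℕ) : NormedSpace ℝ (Cl m) :=
  NormedSpace.induced ℝ (Cl m) (EuclideanSpace ℝ (Finset (Fin m))) (coords m)

theorem norm_sq_eq (m : ℕ) (a : Cl m) : ‖a‖ ^ 2 = ∑ A, (basis m).repr a A ^ 2 := by
  have h : ‖a‖ = ‖coords m a‖ := rfl
  rw [h, EuclideanSpace.norm_sq_eq]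
  simp [coords]

/-! ### Paravectors and the generalized Cauchy–Riemann operator -/

/-- The space `ℝ^{m+1}` of points `x = (x_0, x_1, …, x_m)`. -/
abbrev Pt (m : ℕ) : Type := EuclideanSpace ℝ (Fin (m + 1))

/-- The vector part `(x_1, …, x_m)` of `x`. -/
def vecPart {m : ℕ} (x : Pt m) : EuclideanSpace ℝ (Fin m) :=
  WithLp.toLp 2 fun j => x j.succ

/-- The paravector `x_0 + ∑ x_j e_j`. Its Clifford conjugate is `star (paravector x)`. -/
def paravector {m : ℕ} (x : Pt m) : Cl m :=
  algebraMap ℝ (Cl m) (x 0) + vec m (vecPart x)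

/-- The units `e_0 = 1, e_1, …, e_m`. -/
def unit (m : ℕ) : Fin (m + 1) → Cl m := Fin.cons 1 (e m)

/-- The partial derivative `∂_{x_j} F`. -/
def pderiv {m : ℕ} {V : Type*} [NormedAddCommGroup V] [NormedSpace ℝ V] (j : Fin (m + 1))
    (F : Pt m → V) (x : Pt m) : V :=
  fderiv ℝ F x (EuclideanSpace.single j 1)

/-- The generalized Cauchy–Riemann operator `∂_x = ∑_{j=0}^m e_j ∂_{x_j}` acting from the left. -/
def crLeft {m : ℕ} (F : Pt m → Cl m) (x : Pt m) : Cl m := ∑ j, unit m j * pderiv j F x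

/-- The generalized Cauchy–Riemann operator acting from the right. -/
def crRight {m : ℕ} (F : Pt m → Cl m) (x : Pt m) : Cl m := ∑ j, pderiv j F x * unit m j

/-- `F` is an entire two-sided monogenic function: it is continuously differentiable on the whole
of `ℝ^{m+1}` and `∂_x F = F ∂_x = 0` there. -/
def IsEntireTwoSidedMonogenic {m : ℕ} (F : Pt m → Cl m) : Prop :=
  ContDiff ℝ 1 F ∧ (∀ x, crLeft F x = 0) ∧ ∀ x, crRight F x = 0

/-- `F` is a fundamental solution of `∂_x`: it is locally integrable and `∂_x F = F ∂_x = δ_0` in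
the sense of distributions. -/
def IsFundamentalSolution {m : ℕ} (F : Pt m → Cl m) : Prop :=
  MeasureTheory.LocallyIntegrable F ∧
    ∀ φ : Pt m → ℝ, ContDiff ℝ ∞ φ → HasCompactSupport φ →
      (-∫ x, ∑ j, pderiv j φ x • (unit m j * F x)) = algebraMap ℝ (Cl m) (φ 0) ∧
      (-∫ x, ∑ j, pderiv j φ x • (F x * unit m j)) = algebraMap ℝ (Cl m) (φ 0)

/-! ### Fueter's construction -/

/-- `u(x_0, r) + ω v(x_0, r)`, where `f = u + i v`, `r = |(x_1, …, x_m)|` and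
`ω = (x_1, …, x_m) / r`. At points with `r = 0` the vector `ω` is read as `0`. -/
def axial {m : ℕ} (f : ℂ → ℂ) (x : Pt m) : Cl m :=
  algebraMap ℝ (Cl m) (f ⟨x 0, ‖vecPart x‖⟩).re +
    (f ⟨x 0, ‖vecPart x‖⟩).im • vec m (‖vecPart x‖⁻¹ • vecPart x)

/-- The Fueter image `Δ_x^{k + (m-1)/2} [(u(x_0, r) + ω v(x_0, r)) P(x_1, …, x_m)]` (`m` odd) of
`f = u + i v` and of a homogeneous polynomial `P` of degree `k`. -/
def Ft {m : ℕ} (k : ℕ) (f : ℂ → ℂ) (P : EuclideanSpace ℝ (Fin m) → Cl m) : Pt m → Cl m :=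
  (Laplacian.laplacian : (Pt m → Cl m) → Pt m → Cl m)^[k + (m - 1) / 2]
    fun x => axial f x * P (vecPart x)

/-- The Fueter image `Ft[exp(z²/2)/z, 1]`. -/
def gaussFt (m : ℕ) : Pt m → Cl m := Ft 0 (fun z => Complex.exp (z ^ 2 / 2) / z) fun _ => 1

end Clifford

end

open scoped ContDiff

noncomputable section

namespace Clifford

/-! Write m = 2n + 1 and s = r², where r is the length of the vector part, and write a holomorphic
function as a(x₀, s) + i r b(x₀, s). Let a_k, b_k arise from a, b by applying (1/r)∂_r = 2∂_s k
times. The Cauchy–Riemann equations then express all first derivatives of a_k, b_k through b_k,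
a_{k+1}, b_{k+1}; this closed system is `FueterSystem`. For the Clifford-valued field a_k +
b_k·(vector part) it gives two identities. Its Laplacian is m - 1 - 2k times the next field
(`FueterSystem.laplacian_eq`), and the Cauchy–Riemann operator on either side maps it to (2k + 1 -
m) b_k (`FueterSystem.crLeft_eq`, `FueterSystem.crRight_eq`). Hence Δ^n of the initial field is
(2n)!! times the n-th field, and the n-th field is two-sided monogenic.

Split exp(z²/2)/z as 1/z plus the entire odd function (exp(z²/2) - 1)/z. The system of 1/z is
explicit, and its n-th field is (-1)^n (2n)!! times the Cauchy kernel (`axialField_inv`). The power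
series of the entire part yields a system on the whole (x₀, s)-plane, negative s included. The axis
r = 0 therefore lies in the interior of its domain, and the n-th field is the required entire
monogenic function (`fueterSystem_gauss`, `gaussFt_eq`).

The fundamental solution property reduces to the Cauchy kernel, since the smooth monogenic part
disappears on integrating by parts. Replacing |x|² by |x|² + ε² in the kernel turns its
Cauchy–Riemann derivative into a positive scalar density whose mass does not depend on ε and which
concentrates at 0. Dominated convergence as ε → 0 gives a nonzero multiple of δ₀
(`neg_integral_regKernel_zero`).

For the decay, (1/y)∂_y preserves the form exp(z²/2)·P with P a polynomial in 1/z, z/y, 1/y. Such P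
are bounded on |x| ≤ K, y ≥ R, where |exp(z²/2)| = exp((x² - y²)/2) (`exists_isStripPolynomial`). -/

instance finiteDimensional_cl (m : ℕ) : FiniteDimensional ℝ (Cl m) :=
  Module.Finite.of_basis (basis m)

instance completeSpace_cl (m : ℕ) : CompleteSpace (Cl m) := FiniteDimensional.complete ℝ (Cl m)

/-! ### Clifford relations and the vector part. -/

theorem vec_mul_self (m : ℕ) (v : EuclideanSpace ℝ (Fin m)) :
    vec m v * vec m v = (-‖v‖ ^ 2) • (1 : Cl m) := by
  rw [CliffordAlgebra.ι_sq_scalar, negSq_apply, Algebra.algebraMap_eq_smul_one]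

theorem e_mul_self (m : ℕ) (j : Fin m) : e m j * e m j = -1 := by
  rw [e, vec_mul_self]; simp

theorem sum_smul_e (m : ℕ) (v : EuclideanSpace ℝ (Fin m)) : ∑ j, v j • e m j = vec m v := by
  conv_rhs => rw [← (EuclideanSpace.basisFun (Fin m) ℝ).sum_repr v]
  simp [e]

theorem star_paravector {m : ℕ} (x : Pt m) :
    star (paravector x) = x 0 • (1 : Cl m) - vec m (vecPart x) := by
  simp [paravector, Algebra.algebraMap_eq_smul_one, sub_eq_add_neg]

/-- The vector part as a continuous linear map. -/
def vecPartL (m : ℕ) : Pt m →L[ℝ] EuclideanSpace ℝ (Fin m) :=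
  LinearMap.toContinuousLinearMap
    { toFun := vecPart
      map_add' := fun _ _ => rfl
      map_smul' := fun _ _ => rfl }

@[simp] theorem vecPartL_apply {m : ℕ} (x : Pt m) : vecPartL m x = vecPart x := rfl

@[simp] theorem vecPart_apply {m : ℕ} (x : Pt m) (j : Fin m) : vecPart x j = x j.succ := rfl

@[simp] theorem vecPart_single_zero (m : ℕ) :
    vecPart (EuclideanSpace.single (0 : Fin (m + 1)) (1 : ℝ)) = 0 := by
  ext j; simp [Fin.succ_ne_zero]

@[simp] theorem vecPart_single_succ (m : ℕ) (i : Fin m) :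
    vecPart (EuclideanSpace.single i.succ (1 : ℝ)) = EuclideanSpace.single i 1 := by
  ext j; simp

/-- The embedding of vectors as a continuous linear map. -/
def vecL (m : ℕ) : EuclideanSpace ℝ (Fin m) →L[ℝ] Cl m :=
  LinearMap.toContinuousLinearMap (vec m)

@[simp] theorem vecL_apply {m : ℕ} (v : EuclideanSpace ℝ (Fin m)) : vecL m v = vec m v := rfl

theorem norm_sq_eq_add {m : ℕ} (x : Pt m) : ‖x‖ ^ 2 = x 0 ^ 2 + ‖vecPart x‖ ^ 2 := by
  simp [EuclideanSpace.norm_sq_eq, Fin.sum_univ_succ]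

/-! ### Systems of iterated radial derivatives. -/

/-- The functions `a_k, b_k` of `(x, s)` obtained from the two components of a holomorphic
function `a(x, r²) + i r b(x, r²)` by applying `k` times the operator `(1/r) ∂_r = 2 ∂_s`. -/
structure FueterSystem (Ω : Set (ℝ × ℝ)) (a b : ℕ → ℝ × ℝ → ℝ) : Prop where
  hasFDerivAt_left : ∀ k, ∀ p ∈ Ω, HasFDerivAt (a k)
    (((2 * k + 1) * b k p + p.2 * b (k + 1) p) • ContinuousLinearMap.fst ℝ ℝ ℝ
      + (a (k + 1) p / 2) • ContinuousLinearMap.snd ℝ ℝ ℝ) p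
  hasFDerivAt_right : ∀ k, ∀ p ∈ Ω, HasFDerivAt (b k)
    ((-a (k + 1) p) • ContinuousLinearMap.fst ℝ ℝ ℝ
      + (b (k + 1) p / 2) • ContinuousLinearMap.snd ℝ ℝ ℝ) p

namespace FueterSystem
variable {Ω : Set (ℝ × ℝ)} {a b : ℕ → ℝ × ℝ → ℝ}

theorem mono {Ω' : Set (ℝ × ℝ)} (h : FueterSystem Ω a b) (hΩ : Ω' ⊆ Ω) : FueterSystem Ω' a b :=
  ⟨fun k p hp => h.1 k p (hΩ hp), fun k p hp => h.2 k p (hΩ hp)⟩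

theorem add {a' b' : ℕ → ℝ × ℝ → ℝ} (h : FueterSystem Ω a b) (h' : FueterSystem Ω a' b') :
    FueterSystem Ω (a + a') (b + b') := by
  refine ⟨fun k p hp => ?_, fun k p hp => ?_⟩
  · refine ((h.1 k p hp).add (h'.1 k p hp)).congr_fderiv ?_
    ext <;> simp <;> ring
  · refine ((h.2 k p hp).add (h'.2 k p hp)).congr_fderiv ?_
    ext <;> simp <;> ring

/-- Bootstrapping: the derivatives of members of the system are again built from members, so
regularity C^N for all k at once gives C^(N+1) for all k. -/
theorem contDiffOn (h : FueterSystem Ω a b) (hΩ : IsOpen Ω) (N : ℕ) :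
    ∀ k, ContDiffOn ℝ N (a k) Ω ∧ ContDiffOn ℝ N (b k) Ω := by
  induction N with
  | zero =>
    intro k
    simp only [Nat.cast_zero, contDiffOn_zero]
    exact ⟨fun p hp => (h.1 k p hp).continuousAt.continuousWithinAt,
      fun p hp => (h.2 k p hp).continuousAt.continuousWithinAt⟩
  | succ N ih =>
    intro k
    have key : ∀ (f : ℝ × ℝ → ℝ) (f' : ℝ × ℝ → ℝ × ℝ →L[ℝ] ℝ),
        (∀ p ∈ Ω, HasFDerivAt f (f' p) p) → ContDiffOn ℝ N f' Ω → ContDiffOn ℝ (N + 1 : ℕ) f Ω := by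
      intro f f' hf hf'
      push_cast
      rw [contDiffOn_succ_iff_fderiv_of_isOpen hΩ]
      refine ⟨fun p hp => (hf p hp).differentiableAt.differentiableWithinAt, by simp, ?_⟩
      exact hf'.congr fun p hp => (hf p hp).fderiv
    have ak := ih k
    have ak' := ih (k + 1)
    have hs : ContDiffOn ℝ N (fun p : ℝ × ℝ => p.2) Ω := contDiff_snd.contDiffOn
    constructor
    · exact key _ _ (h.1 k) ((((contDiffOn_const.mul ak.2).add (hs.mul ak'.2)).smul
        contDiffOn_const).add ((ak'.1.div_const 2).smul contDiffOn_const))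
    · exact key _ _ (h.2 k) ((ak'.1.neg.smul contDiffOn_const).add
        ((ak'.2.div_const 2).smul contDiffOn_const))

end FueterSystem

/-! ### Axially symmetric fields and their first derivatives. -/

/-- The point `(x_0, |(x_1, …, x_m)|²)`. -/
def profile {m : ℕ} (x : Pt m) : ℝ × ℝ := (x 0, ‖vecPart x‖ ^ 2)

/-- The axially symmetric function `a(x_0, r²) + (x_1 e_1 + ⋯ + x_m e_m) b(x_0, r²)`. -/
def axialField (m : ℕ) (a b : ℝ × ℝ → ℝ) (x : Pt m) : Cl m :=
  a (profile x) • (1 : Cl m) + b (profile x) • vec m (vecPart x)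

theorem contDiff_profile (m : ℕ) {N : WithTop ℕ∞} : ContDiff ℝ N (profile : Pt m → ℝ × ℝ) := by
  refine ContDiff.prodMk (EuclideanSpace.proj (0 : Fin (m + 1)) : Pt m →L[ℝ] ℝ).contDiff ?_
  exact (vecPartL m).contDiff.norm_sq ℝ

theorem continuous_profile (m : ℕ) : Continuous (profile : Pt m → ℝ × ℝ) :=
  (contDiff_profile m (N := 0)).continuous

theorem contDiffAt_axialField {m : ℕ} {N : WithTop ℕ∞} {a b : ℝ × ℝ → ℝ} {x : Pt m}
    (ha : ContDiffAt ℝ N a (profile x)) (hb : ContDiffAt ℝ N b (profile x)) :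
    ContDiffAt ℝ N (axialField m a b) x := by
  have h₁ : ContDiffAt ℝ N (fun y => a (profile y)) x := ha.comp x (contDiff_profile m).contDiffAt
  have h₂ : ContDiffAt ℝ N (fun y => b (profile y)) x := hb.comp x (contDiff_profile m).contDiffAt
  have h₃ : ContDiffAt ℝ N (fun y => vec m (vecPart y)) x :=
    ((vecL m).comp (vecPartL m)).contDiff.contDiffAt
  exact (h₁.smul contDiffAt_const).add (h₂.smul h₃)

theorem hasFDerivAt_profile {m : ℕ} (x : Pt m) :
    HasFDerivAt profile ((EuclideanSpace.proj (0 : Fin (m + 1)) : Pt m →L[ℝ] ℝ).prod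
      ((2 : ℝ) • (innerSL ℝ (vecPart x)).comp (vecPartL m))) x := by
  refine HasFDerivAt.prodMk (EuclideanSpace.proj (0 : Fin (m + 1)) : Pt m →L[ℝ] ℝ).hasFDerivAt ?_
  refine ((vecPartL m).hasFDerivAt (x := x)).norm_sq.congr_fderiv ?_
  ext v; simp

theorem pderiv_comp_profile_zero {m : ℕ} {f : ℝ × ℝ → ℝ} {x : Pt m} {c d : ℝ}
    (h : HasFDerivAt f (c • ContinuousLinearMap.fst ℝ ℝ ℝ + d • ContinuousLinearMap.snd ℝ ℝ ℝ)
      (profile x)) : pderiv 0 (fun y => f (profile y)) x = c := by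
  have := h.comp x (hasFDerivAt_profile x)
  rw [pderiv]
  rw [show (fun y => f (profile y)) = f ∘ profile from rfl, this.fderiv]
  simp

theorem pderiv_comp_profile_succ {m : ℕ} {f : ℝ × ℝ → ℝ} {x : Pt m} {c d : ℝ}
    (h : HasFDerivAt f (c • ContinuousLinearMap.fst ℝ ℝ ℝ + d • ContinuousLinearMap.snd ℝ ℝ ℝ)
      (profile x)) (i : Fin m) :
    pderiv i.succ (fun y => f (profile y)) x = 2 * d * x i.succ := by
  have := h.comp x (hasFDerivAt_profile x)
  rw [pderiv]
  rw [show (fun y => f (profile y)) = f ∘ profile from rfl, this.fderiv]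
  simp [EuclideanSpace.inner_single_right, Fin.succ_ne_zero]
  ring

section pderiv
variable {m : ℕ} {V : Type*} [NormedAddCommGroup V] [NormedSpace ℝ V]

theorem pderiv_add {F G : Pt m → V} {x : Pt m} (j : Fin (m + 1)) (hF : DifferentiableAt ℝ F x)
    (hG : DifferentiableAt ℝ G x) :
    pderiv j (fun y => F y + G y) x = pderiv j F x + pderiv j G x := by
  simp only [pderiv]
  rw [show (fun y => F y + G y) = F + G from rfl, fderiv_add hF hG]; rfl

theorem pderiv_smul {f : Pt m → ℝ} {G : Pt m → V} {x : Pt m} (j : Fin (m + 1))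
    (hf : DifferentiableAt ℝ f x) (hG : DifferentiableAt ℝ G x) :
    pderiv j (fun y => f y • G y) x = f x • pderiv j G x + pderiv j f x • G x := by
  simp only [pderiv]
  rw [show (fun y => f y • G y) = f • G from rfl, fderiv_smul hf hG]; simp

theorem pderiv_const (j : Fin (m + 1)) (c : V) (x : Pt m) : pderiv j (fun _ => c) x = 0 := by
  simp [pderiv]

theorem pderiv_clm (L : Pt m →L[ℝ] V) (j : Fin (m + 1)) (x : Pt m) :
    pderiv j (fun y => L y) x = L (EuclideanSpace.single j 1) := by
  simp [pderiv]

theorem pderiv_congr {F G : Pt m → V} {x : Pt m} (j : Fin (m + 1)) (h : F =ᶠ[nhds x] G) :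
    pderiv j F x = pderiv j G x := by
  rw [pderiv, pderiv, h.fderiv_eq]

theorem laplacian_eq_sum_pderiv {F : Pt m → V} {x : Pt m} (hF : ContDiffAt ℝ 2 F x) :
    Laplacian.laplacian F x = ∑ j, pderiv j (pderiv j F) x := by
  rw [InnerProductSpace.laplacian_eq_iteratedFDeriv_orthonormalBasis F
    (EuclideanSpace.basisFun (Fin (m + 1)) ℝ)]
  refine Finset.sum_congr rfl fun j _ => ?_
  have hd : DifferentiableAt ℝ (fderiv ℝ F) x :=
    (hF.fderiv_right (m := 1) (by norm_num)).differentiableAt (by norm_num)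
  rw [iteratedFDeriv_two_apply]
  simp only [Matrix.cons_val_zero, Matrix.cons_val_one, EuclideanSpace.basisFun_apply]
  have : pderiv j F = fun y => fderiv ℝ F y (EuclideanSpace.single j 1) := rfl
  rw [this, pderiv, fderiv_clm_apply hd (differentiableAt_const _)]
  simp

end pderiv

section axial
variable {m : ℕ}

theorem differentiableAt_comp_profile {f : ℝ × ℝ → ℝ} {x : Pt m}
    (h : DifferentiableAt ℝ f (profile x)) : DifferentiableAt ℝ (fun y => f (profile y)) x :=
  h.comp x (hasFDerivAt_profile x).differentiableAt

theorem differentiableAt_vec_vecPart (x : Pt m) :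
    DifferentiableAt ℝ (fun y : Pt m => vec m (vecPart y)) x :=
  ((vecL m).comp (vecPartL m)).differentiableAt

theorem pderiv_zero_vec (x : Pt m) : pderiv 0 (fun y : Pt m => vec m (vecPart y)) x = 0 := by
  have := pderiv_clm ((vecL m).comp (vecPartL m)) 0 x
  simpa using this

theorem pderiv_succ_vec (i : Fin m) (x : Pt m) :
    pderiv i.succ (fun y : Pt m => vec m (vecPart y)) x = e m i := by
  have := pderiv_clm ((vecL m).comp (vecPartL m)) i.succ x
  simpa [e] using this

theorem pderiv_zero_axialField {a b : ℝ × ℝ → ℝ} {x : Pt m} {a₁ a₂ b₁ b₂ : ℝ}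
    (ha : HasFDerivAt a (a₁ • ContinuousLinearMap.fst ℝ ℝ ℝ + a₂ • ContinuousLinearMap.snd ℝ ℝ ℝ)
      (profile x))
    (hb : HasFDerivAt b (b₁ • ContinuousLinearMap.fst ℝ ℝ ℝ + b₂ • ContinuousLinearMap.snd ℝ ℝ ℝ)
      (profile x)) :
    pderiv 0 (axialField m a b) x = a₁ • (1 : Cl m) + b₁ • vec m (vecPart x) := by
  have hda := differentiableAt_comp_profile ha.differentiableAt
  have hdb := differentiableAt_comp_profile hb.differentiableAt
  have hv := differentiableAt_vec_vecPart x
  unfold axialField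
  rw [pderiv_add _ (hda.fun_smul (differentiableAt_const _)) (hdb.fun_smul hv),
    pderiv_smul _ hda (differentiableAt_const _), pderiv_smul _ hdb hv, pderiv_const,
    pderiv_zero_vec, pderiv_comp_profile_zero ha, pderiv_comp_profile_zero hb]
  simp

theorem pderiv_succ_axialField {a b : ℝ × ℝ → ℝ} {x : Pt m} {a₁ a₂ b₁ b₂ : ℝ}
    (ha : HasFDerivAt a (a₁ • ContinuousLinearMap.fst ℝ ℝ ℝ + a₂ • ContinuousLinearMap.snd ℝ ℝ ℝ)
      (profile x))
    (hb : HasFDerivAt b (b₁ • ContinuousLinearMap.fst ℝ ℝ ℝ + b₂ • ContinuousLinearMap.snd ℝ ℝ ℝ)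
      (profile x)) (i : Fin m) :
    pderiv i.succ (axialField m a b) x = x i.succ • ((2 * a₂) • (1 : Cl m) +
      (2 * b₂) • vec m (vecPart x)) + b (profile x) • e m i := by
  have hda := differentiableAt_comp_profile ha.differentiableAt
  have hdb := differentiableAt_comp_profile hb.differentiableAt
  have hv := differentiableAt_vec_vecPart x
  unfold axialField
  rw [pderiv_add _ (hda.fun_smul (differentiableAt_const _)) (hdb.fun_smul hv),
    pderiv_smul _ hda (differentiableAt_const _), pderiv_smul _ hdb hv, pderiv_const,
    pderiv_succ_vec, pderiv_comp_profile_succ ha, pderiv_comp_profile_succ hb]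
  module

theorem sum_mul_e_left (x : Pt m) (y : Cl m) :
    ∑ i : Fin m, e m i * (x i.succ • y) = vec m (vecPart x) * y := by
  rw [← sum_smul_e, Finset.sum_mul]
  simp

theorem sum_mul_e_right (x : Pt m) (y : Cl m) :
    ∑ i : Fin m, (x i.succ • y) * e m i = y * vec m (vecPart x) := by
  rw [← sum_smul_e, Finset.mul_sum]
  simp

/-- The term 2 b₂ s comes from the square -s of the vector part, and the term m b from the m squares
e_j² = -1. The right-hand version agrees because only the vector part and the individual e_j get
multiplied by themselves. -/
theorem crLeft_axialField {a b : ℝ × ℝ → ℝ} {x : Pt m} {a₁ a₂ b₁ b₂ : ℝ}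
    (ha : HasFDerivAt a (a₁ • ContinuousLinearMap.fst ℝ ℝ ℝ + a₂ • ContinuousLinearMap.snd ℝ ℝ ℝ)
      (profile x))
    (hb : HasFDerivAt b (b₁ • ContinuousLinearMap.fst ℝ ℝ ℝ + b₂ • ContinuousLinearMap.snd ℝ ℝ ℝ)
      (profile x)) :
    crLeft (axialField m a b) x = (a₁ - 2 * b₂ * (profile x).2 - m * b (profile x)) • (1 : Cl m) +
      (b₁ + 2 * a₂) • vec m (vecPart x) := by
  rw [crLeft, Fin.sum_univ_succ, pderiv_zero_axialField ha hb]
  simp only [pderiv_succ_axialField ha hb, unit, Fin.cons_zero, Fin.cons_succ, mul_add,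
    Finset.sum_add_distrib]
  simp only [← mul_add, sum_mul_e_left]
  simp only [mul_add, mul_smul_comm, vec_mul_self, e_mul_self, one_mul, mul_one, Finset.sum_const,
    Finset.card_univ, Fintype.card_fin, profile]
  module

theorem crRight_axialField {a b : ℝ × ℝ → ℝ} {x : Pt m} {a₁ a₂ b₁ b₂ : ℝ}
    (ha : HasFDerivAt a (a₁ • ContinuousLinearMap.fst ℝ ℝ ℝ + a₂ • ContinuousLinearMap.snd ℝ ℝ ℝ)
      (profile x))
    (hb : HasFDerivAt b (b₁ • ContinuousLinearMap.fst ℝ ℝ ℝ + b₂ • ContinuousLinearMap.snd ℝ ℝ ℝ)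
      (profile x)) :
    crRight (axialField m a b) x = (a₁ - 2 * b₂ * (profile x).2 - m * b (profile x)) • (1 : Cl m) +
      (b₁ + 2 * a₂) • vec m (vecPart x) := by
  rw [crRight, Fin.sum_univ_succ, pderiv_zero_axialField ha hb]
  simp only [pderiv_succ_axialField ha hb, unit, Fin.cons_zero, Fin.cons_succ, add_mul,
    Finset.sum_add_distrib]
  simp only [← add_mul, sum_mul_e_right]
  simp only [add_mul, smul_mul_assoc, vec_mul_self, e_mul_self, one_mul, mul_one, Finset.sum_const,
    Finset.card_univ, Fintype.card_fin, profile]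
  module

end axial

/-! ### The Cauchy–Riemann operator and the Laplacian on the fields of a system. -/

namespace FueterSystem
variable {m : ℕ} {Ω : Set (ℝ × ℝ)} {a b : ℕ → ℝ × ℝ → ℝ}

theorem contDiffAt_axialField (h : FueterSystem Ω a b) (hΩ : IsOpen Ω) (N : ℕ) (k : ℕ) {x : Pt m}
    (hx : profile x ∈ Ω) : ContDiffAt ℝ N (axialField m (a k) (b k)) x :=
  Clifford.contDiffAt_axialField
    (((h.contDiffOn hΩ N k).1).contDiffAt (hΩ.mem_nhds hx))
    (((h.contDiffOn hΩ N k).2).contDiffAt (hΩ.mem_nhds hx))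

/-- The vector part cancels by ∂_x b_k = -a_{k+1} = -2 ∂_s a_k, and the terms s b_{k+1} cancel in
the scalar part. The remaining factor vanishes exactly at m = 2k + 1, which is what makes the field
monogenic. -/
theorem crLeft_eq (h : FueterSystem Ω a b) (k : ℕ) {x : Pt m} (hx : profile x ∈ Ω) :
    crLeft (axialField m (a k) (b k)) x = ((2 * k + 1 - m) * b k (profile x)) • (1 : Cl m) := by
  rw [crLeft_axialField (h.1 k _ hx) (h.2 k _ hx)]
  module

theorem crRight_eq (h : FueterSystem Ω a b) (k : ℕ) {x : Pt m} (hx : profile x ∈ Ω) :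
    crRight (axialField m (a k) (b k)) x = ((2 * k + 1 - m) * b k (profile x)) • (1 : Cl m) := by
  rw [crRight_axialField (h.1 k _ hx) (h.2 k _ hx)]
  module

theorem eventually_profile_mem (hΩ : IsOpen Ω) {x : Pt m} (hx : profile x ∈ Ω) :
    ∀ᶠ y in nhds x, profile y ∈ Ω :=
  (continuous_profile m).continuousAt.eventually (hΩ.mem_nhds hx)

theorem pderiv_zero_pderiv_zero (h : FueterSystem Ω a b) (hΩ : IsOpen Ω) (k : ℕ) {x : Pt m}
    (hx : profile x ∈ Ω) :
    pderiv 0 (pderiv 0 (axialField m (a k) (b k))) x =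
      (-((2 * k + 1) * a (k + 1) (profile x) + (profile x).2 * a (k + 2) (profile x))) • (1 : Cl m)
      - ((2 * k + 3) * b (k + 1) (profile x) + (profile x).2 * b (k + 2) (profile x)) •
        vec m (vecPart x) := by
  have h1 : pderiv 0 (axialField m (a k) (b k)) =ᶠ[nhds x] axialField m
      (fun p => (2 * k + 1) * b k p + p.2 * b (k + 1) p) (fun p => -a (k + 1) p) := by
    filter_upwards [eventually_profile_mem hΩ hx] with y hy
    rw [pderiv_zero_axialField (h.1 k _ hy) (h.2 k _ hy)]; rfl
  rw [pderiv_congr 0 h1]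
  have ha : HasFDerivAt (fun p : ℝ × ℝ => (2 * k + 1) * b k p + p.2 * b (k + 1) p)
      ((-((2 * k + 1) * a (k + 1) (profile x) + (profile x).2 * a (k + 2) (profile x))) •
        ContinuousLinearMap.fst ℝ ℝ ℝ + ((2 * k + 1) * (b (k + 1) (profile x) / 2) +
        (profile x).2 * (b (k + 2) (profile x) / 2) + b (k + 1) (profile x)) •
        ContinuousLinearMap.snd ℝ ℝ ℝ) (profile x) := by
    refine (((h.2 k _ hx).const_mul (2 * (k : ℝ) + 1)).add
      ((ContinuousLinearMap.snd ℝ ℝ ℝ).hasFDerivAt.mul (h.2 (k + 1) _ hx))).congr_fderiv ?_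
    ext <;> simp <;> ring
  have hb : HasFDerivAt (fun p : ℝ × ℝ => -a (k + 1) p)
      ((-((2 * k + 3) * b (k + 1) (profile x) + (profile x).2 * b (k + 2) (profile x))) •
        ContinuousLinearMap.fst ℝ ℝ ℝ + (-(a (k + 2) (profile x) / 2)) •
        ContinuousLinearMap.snd ℝ ℝ ℝ) (profile x) := by
    refine (h.1 (k + 1) _ hx).neg.congr_fderiv ?_
    ext
    · simp; left; ring
    · simp
  rw [pderiv_zero_axialField ha hb]
  module

theorem pderiv_succ_pderiv_succ (h : FueterSystem Ω a b) (hΩ : IsOpen Ω) (k : ℕ) {x : Pt m}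
    (hx : profile x ∈ Ω) (i : Fin m) :
    pderiv i.succ (pderiv i.succ (axialField m (a k) (b k))) x =
      (a (k + 1) (profile x) + x i.succ ^ 2 * a (k + 2) (profile x)) • (1 : Cl m)
      + (b (k + 1) (profile x) + x i.succ ^ 2 * b (k + 2) (profile x)) • vec m (vecPart x)
      + (2 * b (k + 1) (profile x)) • x i.succ • e m i := by
  -- The radial derivative moves one step up the system, so the first derivative is x_i times the
  -- next field plus b_k e_i.
  have h1 : pderiv i.succ (axialField m (a k) (b k)) =ᶠ[nhds x] fun y =>
      y i.succ • axialField m (a (k + 1)) (b (k + 1)) y + b k (profile y) • e m i := by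
    filter_upwards [eventually_profile_mem hΩ hx] with y hy
    rw [pderiv_succ_axialField (h.1 k _ hy) (h.2 k _ hy), axialField]
    module
  have hF : DifferentiableAt ℝ (axialField m (a (k + 1)) (b (k + 1))) x :=
    (h.contDiffAt_axialField hΩ 1 (k + 1) hx).differentiableAt (by norm_num)
  have hc : DifferentiableAt ℝ (fun y : Pt m => y i.succ) x :=
    (EuclideanSpace.proj i.succ : Pt m →L[ℝ] ℝ).differentiableAt
  have hc' : pderiv i.succ (fun y : Pt m => y i.succ) x = 1 := by
    have := pderiv_clm (EuclideanSpace.proj i.succ : Pt m →L[ℝ] ℝ) i.succ x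
    simpa using this
  have hb : DifferentiableAt ℝ (fun y : Pt m => b k (profile y)) x :=
    differentiableAt_comp_profile (h.2 k _ hx).differentiableAt
  rw [pderiv_congr _ h1, pderiv_add _ (hc.fun_smul hF) (hb.fun_smul (differentiableAt_const _)),
    pderiv_smul _ hc hF, pderiv_smul _ hb (differentiableAt_const _), hc', pderiv_const,
    pderiv_comp_profile_succ (h.2 k _ hx), pderiv_succ_axialField (h.1 _ _ hx) (h.2 _ _ hx),
    axialField]
  module

/-- On summing second derivatives the terms s a_{k+2} and s b_{k+2} cancel. What is left is m - (2k
+ 1) in the scalar part and m + 2 - (2k + 3) in the vector part, the 2 coming from the cross terms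
x_i e_i. -/
theorem laplacian_eq (h : FueterSystem Ω a b) (hΩ : IsOpen Ω) (k : ℕ) {x : Pt m}
    (hx : profile x ∈ Ω) :
    Laplacian.laplacian (axialField m (a k) (b k)) x =
      ((m : ℝ) - 1 - 2 * k) • axialField m (a (k + 1)) (b (k + 1)) x := by
  rw [laplacian_eq_sum_pderiv (h.contDiffAt_axialField hΩ 2 k hx), Fin.sum_univ_succ,
    h.pderiv_zero_pderiv_zero hΩ k hx]
  simp only [h.pderiv_succ_pderiv_succ hΩ k hx, Finset.sum_add_distrib, ← Finset.sum_smul,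
    ← Finset.smul_sum, ← Finset.sum_mul]
  have hs : ∑ i : Fin m, x i.succ ^ 2 = (profile x).2 := by
    simp [profile, EuclideanSpace.norm_sq_eq]
  have hv : ∑ i : Fin m, x i.succ • e m i = vec m (vecPart x) := by
    rw [← sum_smul_e]; rfl
  rw [hs, hv, axialField]
  simp only [Finset.sum_const, Finset.card_univ, Fintype.card_fin, nsmul_eq_mul]
  module

/-- `Δ^k` of an axial function is a multiple of the `k`-th function of the system. -/
theorem iterate_laplacian_eq (h : FueterSystem Ω a b) (hΩ : IsOpen Ω) (k : ℕ)
    {F : Pt m → Cl m} (hF : ∀ x, profile x ∈ Ω → F x = axialField m (a 0) (b 0) x) :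
    ∀ x, profile x ∈ Ω → (Laplacian.laplacian : (Pt m → Cl m) → Pt m → Cl m)^[k] F x =
      (∏ j ∈ Finset.range k, ((m : ℝ) - 1 - 2 * j)) • axialField m (a k) (b k) x := by
  induction k with
  | zero => intro x hx; simp [hF x hx]
  | succ k ih =>
    intro x hx
    rw [Function.iterate_succ_apply']
    have he : (Laplacian.laplacian : (Pt m → Cl m) → Pt m → Cl m)^[k] F =ᶠ[nhds x]
        (∏ j ∈ Finset.range k, ((m : ℝ) - 1 - 2 * j)) • axialField m (a k) (b k) := by
      filter_upwards [eventually_profile_mem hΩ hx] with y hy using ih y hy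
    rw [(InnerProductSpace.laplacian_congr_nhds he).eq_of_nhds,
      InnerProductSpace.laplacian_smul _ (h.contDiffAt_axialField hΩ 2 k hx),
      h.laplacian_eq hΩ k hx, Finset.prod_range_succ, mul_smul]

end FueterSystem

theorem prod_range_sub_eq_doubleFactorial (n : ℕ) :
    ∏ j ∈ Finset.range n, (((2 * n + 1 : ℕ) : ℝ) - 1 - 2 * j) = ((2 * n).doubleFactorial : ℝ) := by
  -- The factors are 2(n - j); reversing the order of one product matches them with 2^n n!.
  rw [Nat.doubleFactorial_two_mul, ← Finset.prod_range_add_one_eq_factorial,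
    ← Finset.prod_range_reflect]
  push_cast
  rw [← Finset.card_range n, ← Finset.prod_const, Finset.card_range, ← Finset.prod_mul_distrib]
  refine Finset.prod_congr rfl fun j hj => ?_
  have : j < n := Finset.mem_range.1 hj
  rw [show n - 1 - j = n - (j + 1) by omega, Nat.cast_sub this]
  push_cast; ring

/-! ### Systems of concrete functions and their closure properties. -/

namespace FueterSystem

/-- The system of `1 / z`. -/
theorem of_inv : FueterSystem {p | p.1 ^ 2 + p.2 ≠ 0}
    (fun k p => (-2) ^ k * k.factorial * (p.1 * ((p.1 ^ 2 + p.2) ^ (k + 1))⁻¹))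
    (fun k p => -((-2) ^ k * k.factorial * ((p.1 ^ 2 + p.2) ^ (k + 1))⁻¹)) := by
  have key : ∀ (k : ℕ) (p : ℝ × ℝ), p.1 ^ 2 + p.2 ≠ 0 →
      HasFDerivAt (fun p : ℝ × ℝ => ((p.1 ^ 2 + p.2) ^ (k + 1))⁻¹)
        ((-(k + 1) * ((p.1 ^ 2 + p.2) ^ (k + 2))⁻¹) •
          ((2 * p.1) • ContinuousLinearMap.fst ℝ ℝ ℝ + ContinuousLinearMap.snd ℝ ℝ ℝ)) p := by
    intro k p hp
    have h1 : HasFDerivAt (fun p : ℝ × ℝ => p.1 ^ 2 + p.2)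
        ((2 * p.1) • ContinuousLinearMap.fst ℝ ℝ ℝ + ContinuousLinearMap.snd ℝ ℝ ℝ) p := by
      refine (((ContinuousLinearMap.fst ℝ ℝ ℝ).hasFDerivAt.pow 2).add
        (ContinuousLinearMap.snd ℝ ℝ ℝ).hasFDerivAt).congr_fderiv ?_
      ext <;> simp
    have h2 := ((hasDerivAt_pow (k + 1) (p.1 ^ 2 + p.2)).inv (pow_ne_zero _ hp)).comp_hasFDerivAt p h1
    refine h2.congr_fderiv ?_
    congr 1
    push_cast
    field_simp
    simp
    ring
  refine ⟨fun k p hp => ?_, fun k p hp => ?_⟩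
  · refine (((ContinuousLinearMap.fst ℝ ℝ ℝ).hasFDerivAt.mul (key k p hp)).const_mul
      ((-2) ^ k * (k.factorial : ℝ))).congr_fderiv ?_
    have hp' : p.1 ^ 2 + p.2 ≠ 0 := hp
    ext
    · simp [Nat.factorial_succ]
      field_simp
      ring
    · simp [Nat.factorial_succ]
      field_simp
      ring
  · refine ((key k p hp).const_mul ((-2) ^ k * (k.factorial : ℝ))).neg.congr_fderiv ?_
    have hp' : p.1 ^ 2 + p.2 ≠ 0 := hp
    ext
    · simp [Nat.factorial_succ]
      field_simp
      ring
    · simp [Nat.factorial_succ]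
      field_simp
      ring

variable {Ω : Set (ℝ × ℝ)} {a b : ℕ → ℝ × ℝ → ℝ}

/-- The system of the constant `1`. -/
theorem of_one : FueterSystem Set.univ (fun k _ => if k = 0 then 1 else 0) 0 := by
  refine ⟨fun k p _ => ?_, fun k p _ => ?_⟩
  · refine (hasFDerivAt_const _ _).congr_fderiv ?_
    ext <;> simp
  · refine (hasFDerivAt_const _ _).congr_fderiv ?_
    ext <;> simp

/-- The system of `z f(z)` in terms of that of `f`. -/
theorem mul_id (h : FueterSystem Ω a b) :
    FueterSystem Ω (fun k p => p.1 * a k p - p.2 * b k p - 2 * k * b (k - 1) p)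
      (fun k p => p.1 * b k p + a k p) := by
  have hx (p : ℝ × ℝ) := (ContinuousLinearMap.fst ℝ ℝ ℝ).hasFDerivAt (x := p)
  have hs (p : ℝ × ℝ) := (ContinuousLinearMap.snd ℝ ℝ ℝ).hasFDerivAt (x := p)
  refine ⟨fun k p hp => ?_, fun k p hp => ?_⟩
  · refine ((((hx p).mul (h.1 k p hp)).sub ((hs p).mul (h.2 k p hp))).sub
      ((h.2 (k - 1) p hp).const_mul (2 * (k : ℝ)))).congr_fderiv ?_
    -- The term 2k b_{k-1} is the Leibniz correction in (2∂_s)^k (s b). At k = 0 the truncated index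
    -- k - 1 = 0 is harmless because of the factor k.
    rcases k with _ | k
    · ext
      · simp; ring
      · simp; ring
    · ext
      · simp; ring
      · simp; ring
  · refine (((hx p).mul (h.2 k p hp)).add (h.1 k p hp)).congr_fderiv ?_
    ext
    · simp; ring
    · simp; ring

theorem const_smul (h : FueterSystem Ω a b) (c : ℝ) :
    FueterSystem Ω (fun k p => c * a k p) (fun k p => c * b k p) := by
  refine ⟨fun k p hp => ?_, fun k p hp => ?_⟩
  · refine ((h.1 k p hp).const_mul c).congr_fderiv ?_
    ext <;> simp <;> ring
  · refine ((h.2 k p hp).const_mul c).congr_fderiv ?_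
    ext <;> simp; ring

/-- A series of systems that converges locally uniformly. -/
theorem tsum {A B : ℕ → ℕ → ℝ × ℝ → ℝ} (h : ∀ j, FueterSystem Set.univ (A j) (B j))
    (hu : ∀ (R : ℝ) (k : ℕ), ∃ u : ℕ → ℝ, Summable u ∧
      ∀ j, ∀ p ∈ Metric.ball (0 : ℝ × ℝ) R, |A j k p| ≤ u j ∧ |B j k p| ≤ u j) :
    FueterSystem Set.univ (fun k p => ∑' j, A j k p) (fun k p => ∑' j, B j k p) := by
  have hsum : ∀ k p, (Summable fun j => A j k p) ∧ Summable fun j => B j k p := by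
    intro k p
    obtain ⟨u, hu, hub⟩ := hu (‖p‖ + 1) k
    have hp : p ∈ Metric.ball (0 : ℝ × ℝ) (‖p‖ + 1) := by simp
    exact ⟨.of_norm_bounded hu fun j => (hub j p hp).1, .of_norm_bounded hu fun j => (hub j p hp).2⟩
  have hnorm : ∀ α β : ℝ, ‖α • ContinuousLinearMap.fst ℝ ℝ ℝ + β • ContinuousLinearMap.snd ℝ ℝ ℝ‖
      ≤ |α| + |β| := by
    intro α β
    refine (norm_add_le _ _).trans (add_le_add ?_ ?_)
    · rw [norm_smul]
      exact mul_le_of_le_one_right (abs_nonneg _) (ContinuousLinearMap.norm_fst_le ℝ ℝ ℝ)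
    · rw [norm_smul]
      exact mul_le_of_le_one_right (abs_nonneg _) (ContinuousLinearMap.norm_snd_le ℝ ℝ ℝ)
  have key : ∀ (f : ℕ → ℝ × ℝ → ℝ) (α β : ℕ → ℝ × ℝ → ℝ) (p : ℝ × ℝ) (u : ℕ → ℝ),
      (∀ j q, HasFDerivAt (f j)
        (α j q • ContinuousLinearMap.fst ℝ ℝ ℝ + β j q • ContinuousLinearMap.snd ℝ ℝ ℝ) q) →
      Summable (fun j => f j p) → Summable (fun j => α j p) → Summable (fun j => β j p) →
      Summable u → (∀ j, ∀ q ∈ Metric.ball (0 : ℝ × ℝ) (‖p‖ + 1), |α j q| + |β j q| ≤ u j) →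
      HasFDerivAt (fun q => ∑' j, f j q) ((∑' j, α j p) • ContinuousLinearMap.fst ℝ ℝ ℝ +
        (∑' j, β j p) • ContinuousLinearMap.snd ℝ ℝ ℝ) p := by
    intro f α β p u hf hfs hα hβ hus hub
    have hp : p ∈ Metric.ball (0 : ℝ × ℝ) (‖p‖ + 1) := by simp
    -- The uniform bounds hold only on bounded sets, so the series is differentiated termwise on a
    -- ball around 0 chosen to contain p.
    have := hasFDerivAt_tsum_of_isPreconnected hus Metric.isOpen_ball
      (convex_ball (0 : ℝ × ℝ) (‖p‖ + 1)).isPreconnected (fun j q _ => hf j q)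
      (fun j q hq => (hnorm _ _).trans (hub j q hq)) hp hfs hp
    refine this.congr_fderiv ?_
    exact ((hα.hasSum.smul_const _).add (hβ.hasSum.smul_const _)).tsum_eq
  refine ⟨fun k p _ => ?_, fun k p _ => ?_⟩
  · obtain ⟨u, hus, hub⟩ := hu (‖p‖ + 1) k
    obtain ⟨v, hvs, hvb⟩ := hu (‖p‖ + 1) (k + 1)
    have h1 := (hsum k p).2.mul_left (2 * (k : ℝ) + 1)
    have h2 := (hsum (k + 1) p).2.mul_left p.2
    have := key (fun j => A j k) (fun j q => (2 * k + 1) * B j k q + q.2 * B j (k + 1) q)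
      (fun j q => A j (k + 1) q / 2) p
      (fun j => ((2 * k + 1) * u j + (‖p‖ + 1) * v j) + v j / 2)
      (fun j q => (h j).1 k q trivial) (hsum k p).1 (h1.add h2)
      ((hsum (k + 1) p).1.div_const 2)
      (((hus.mul_left _).add (hvs.mul_left _)).add (hvs.div_const 2)) ?_
    · refine this.congr_fderiv ?_
      rw [h1.tsum_add h2, tsum_mul_left, tsum_mul_left, tsum_div_const]
    · intro j q hq
      have hq2 : |q.2| ≤ ‖p‖ + 1 :=
        (norm_snd_le q).trans (by simpa using (mem_ball_zero_iff.1 hq).le)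
      refine add_le_add ((abs_add_le _ _).trans (add_le_add ?_ ?_)) ?_
      · rw [abs_mul, abs_of_nonneg (by positivity : (0 : ℝ) ≤ 2 * k + 1)]
        exact mul_le_mul_of_nonneg_left (hub j q hq).2 (by positivity)
      · rw [abs_mul]
        exact mul_le_mul hq2 (hvb j q hq).2 (abs_nonneg _) (by positivity)
      · rw [abs_div, abs_two]
        have := (hvb j q hq).1
        linarith
  · obtain ⟨v, hvs, hvb⟩ := hu (‖p‖ + 1) (k + 1)
    have := key (fun j => B j k) (fun j q => -A j (k + 1) q)
      (fun j q => B j (k + 1) q / 2) p (fun j => v j + v j / 2)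
      (fun j q => (h j).2 k q trivial) (hsum k p).2 (hsum (k + 1) p).1.neg
      ((hsum (k + 1) p).2.div_const 2) (hvs.add (hvs.div_const 2)) ?_
    · refine this.congr_fderiv ?_
      rw [tsum_neg, tsum_div_const]
    · intro j q hq
      refine add_le_add ?_ ?_
      · rw [abs_neg]; exact (hvb j q hq).1
      · rw [abs_div, abs_two]
        have := (hvb j q hq).2
        linarith

end FueterSystem

/-! ### Powers of z and the entire function (exp(z²/2) - 1)/z. -/

/-- The pair of functions `(a_k, b_k)` belonging to `z ^ N`. -/
def powPair : ℕ → ℕ → ℝ × ℝ → ℝ × ℝ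
  | 0, k, _ => (if k = 0 then 1 else 0, 0)
  | N + 1, k, p => (p.1 * (powPair N k p).1 - p.2 * (powPair N k p).2
      - 2 * k * (powPair N (k - 1) p).2, p.1 * (powPair N k p).2 + (powPair N k p).1)

theorem fueterSystem_powPair (N : ℕ) : FueterSystem Set.univ (fun k p => (powPair N k p).1)
    (fun k p => (powPair N k p).2) := by
  induction N with
  | zero => exact FueterSystem.of_one
  | succ N ih => exact ih.mul_id

/-- One multiplication by z enlarges the pair at level k by at most the factor 2(1 + R) from the
coordinates plus 2k from the Leibniz correction. For fixed k the growth in N is thus only geometric,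
and the coefficients `gaussCoeff` outweigh it. -/
theorem powPair_bound {R : ℝ} {p : ℝ × ℝ} (hp : ‖p‖ ≤ R) (N : ℕ) : ∀ k : ℕ,
    |(powPair N k p).1| + |(powPair N k p).2| ≤ (2 * (1 + R) + 2 * k) ^ N := by
  have hR : 0 ≤ R := (norm_nonneg p).trans hp
  have h1 : |p.1| ≤ R := (norm_fst_le p).trans hp
  have h2 : |p.2| ≤ R := (norm_snd_le p).trans hp
  induction N with
  | zero => intro k; simp only [powPair]; split_ifs <;> simp
  | succ N ih =>
    intro k
    set a := (powPair N k p).1 with ha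
    set b := (powPair N k p).2 with hb
    set b' := (powPair N (k - 1) p).2 with hb'
    have hk := ih k
    have hk' : |b'| ≤ (2 * (1 + R) + 2 * k) ^ N := by
      have h3 := ih (k - 1)
      have h4 : ((k - 1 : ℕ) : ℝ) ≤ k := by exact_mod_cast Nat.sub_le k 1
      have h5 : (2 * (1 + R) + 2 * ((k - 1 : ℕ) : ℝ)) ^ N ≤ (2 * (1 + R) + 2 * k) ^ N :=
        pow_le_pow_left₀ (by positivity) (by linarith) N
      have := abs_nonneg (powPair N (k - 1) p).1
      linarith
    set W := (2 * (1 + R) + 2 * (k : ℝ)) ^ N with hW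
    have e1 : |p.1 * a| ≤ R * |a| := by rw [abs_mul]; gcongr
    have e2 : |p.2 * b| ≤ R * |b| := by rw [abs_mul]; gcongr
    have e3 : |p.1 * b| ≤ R * |b| := by rw [abs_mul]; gcongr
    have e4 : |2 * k * b'| ≤ 2 * k * W := by
      rw [abs_mul, abs_of_nonneg (by positivity : (0 : ℝ) ≤ 2 * k)]; gcongr
    have e5 : |p.1 * a - p.2 * b - 2 * k * b'| ≤ R * |a| + R * |b| + 2 * k * W :=
      (abs_sub _ _).trans (add_le_add ((abs_sub _ _).trans (add_le_add e1 e2)) e4)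
    have e6 : |p.1 * b + a| ≤ R * |b| + |a| := (abs_add_le _ _).trans (by gcongr)
    have e7 : 2 * (1 + R) * (|a| + |b|) ≤ 2 * (1 + R) * W := by gcongr
    have : (powPair (N + 1) k p).1 = p.1 * a - p.2 * b - 2 * k * b' := rfl
    rw [this, show (powPair (N + 1) k p).2 = p.1 * b + a from rfl, pow_succ, ← hW]
    nlinarith [abs_nonneg a, abs_nonneg b, mul_nonneg hR (abs_nonneg a)]

theorem powPair_complex (N : ℕ) (z : ℂ) :
    (z ^ N).re = (powPair N 0 (z.re, z.im ^ 2)).1 ∧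
      (z ^ N).im = z.im * (powPair N 0 (z.re, z.im ^ 2)).2 := by
  induction N with
  | zero => simp [powPair]
  | succ N ih =>
    rw [pow_succ, Complex.mul_re, Complex.mul_im, ih.1, ih.2]
    simp only [powPair, CharP.cast_eq_zero]
    constructor <;> ring

/-- The coefficients of `(exp(z²/2) - 1)/z = ∑ c_j z^(2j+1)`. -/
def gaussCoeff (j : ℕ) : ℝ := (2 ^ (j + 1) * (j + 1).factorial : ℝ)⁻¹

theorem gaussCoeff_pos (j : ℕ) : 0 < gaussCoeff j := by unfold gaussCoeff; positivity

/-- This is the exponential series without its constant term, divided by z. -/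
theorem hasSum_gaussCoeff {z : ℂ} (hz : z ≠ 0) :
    HasSum (fun j => (gaussCoeff j : ℂ) * z ^ (2 * j + 1)) ((Complex.exp (z ^ 2 / 2) - 1) / z) := by
  have h := NormedSpace.expSeries_div_hasSum_exp (z ^ 2 / 2)
  rw [← Complex.exp_eq_exp_ℂ] at h
  have h1 := ((hasSum_nat_add_iff' 1).2 h).div_const z
  simp only [Finset.range_one, Finset.sum_singleton, pow_zero, Nat.factorial_zero, Nat.cast_one,
    div_one] at h1
  refine h1.congr_fun ?_
  intro j
  simp only [gaussCoeff]
  push_cast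
  rw [div_pow]
  have : ((j + 1).factorial : ℂ) ≠ 0 := by exact_mod_cast (j + 1).factorial_ne_zero
  field_simp
  ring

theorem summable_gaussCoeff (y : ℝ) : Summable fun j => gaussCoeff j * y ^ (2 * j + 1) := by
  rcases eq_or_ne y 0 with rfl | hy
  · simp
  · have h := hasSum_gaussCoeff (z := (y : ℂ)) (by exact_mod_cast hy)
    have := (Complex.reCLM.hasSum h).summable
    refine this.congr fun j => ?_
    simp only [Complex.reCLM_apply]
    norm_cast

/-- The first components of the system of `(exp(z²/2) - 1)/z`. -/
def gaussLeft (k : ℕ) (p : ℝ × ℝ) : ℝ := ∑' j, gaussCoeff j * (powPair (2 * j + 1) k p).1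

/-- The second components of the system of `(exp(z²/2) - 1)/z`. -/
def gaussRight (k : ℕ) (p : ℝ × ℝ) : ℝ := ∑' j, gaussCoeff j * (powPair (2 * j + 1) k p).2

/-- The majorant at level k on the ball of radius R is the same power series evaluated at the real
number 2(1 + R) + 2k. -/
theorem fueterSystem_gauss : FueterSystem Set.univ gaussLeft gaussRight := by
  refine FueterSystem.tsum (fun j => (fueterSystem_powPair (2 * j + 1)).const_smul (gaussCoeff j))
    fun R k => ⟨_, summable_gaussCoeff (2 * (1 + R) + 2 * k), fun j p hp => ?_⟩
  have := powPair_bound (mem_ball_zero_iff.1 hp).le (2 * j + 1) k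
  have hc := gaussCoeff_pos j
  constructor
  · rw [abs_mul, abs_of_pos hc]
    exact mul_le_mul_of_nonneg_left ((le_add_of_nonneg_right (abs_nonneg _)).trans this) hc.le
  · rw [abs_mul, abs_of_pos hc]
    exact mul_le_mul_of_nonneg_left ((le_add_of_nonneg_left (abs_nonneg _)).trans this) hc.le

theorem gauss_complex {z : ℂ} (hz : z ≠ 0) :
    ((Complex.exp (z ^ 2 / 2) - 1) / z).re = gaussLeft 0 (z.re, z.im ^ 2) ∧
      ((Complex.exp (z ^ 2 / 2) - 1) / z).im = z.im * gaussRight 0 (z.re, z.im ^ 2) := by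
  have h := hasSum_gaussCoeff hz
  constructor
  · rw [gaussLeft, ← Complex.reCLM_apply, ← (Complex.reCLM.hasSum h).tsum_eq]
    refine tsum_congr fun j => ?_
    simp [(powPair_complex (2 * j + 1) z).1]
  · rw [gaussRight, ← tsum_mul_left, ← Complex.imCLM_apply, ← (Complex.imCLM.hasSum h).tsum_eq]
    refine tsum_congr fun j => ?_
    simp [(powPair_complex (2 * j + 1) z).2]
    ring

/-! ### Splitting off the Cauchy kernel. -/

/-- The first components of the system of `1 / z`. -/
def invLeft (k : ℕ) (p : ℝ × ℝ) : ℝ :=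
  (-2) ^ k * k.factorial * (p.1 * ((p.1 ^ 2 + p.2) ^ (k + 1))⁻¹)

/-- The second components of the system of `1 / z`. -/
def invRight (k : ℕ) (p : ℝ × ℝ) : ℝ :=
  -((-2) ^ k * k.factorial * ((p.1 ^ 2 + p.2) ^ (k + 1))⁻¹)

theorem fueterSystem_inv : FueterSystem {p | p.1 ^ 2 + p.2 ≠ 0} invLeft invRight :=
  FueterSystem.of_inv

theorem fueterSystem_inv_add_gauss :
    FueterSystem {p | p.1 ^ 2 + p.2 ≠ 0} (invLeft + gaussLeft) (invRight + gaussRight) :=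
  fueterSystem_inv.add (fueterSystem_gauss.mono (Set.subset_univ _))

theorem isOpen_inv_domain : IsOpen {p : ℝ × ℝ | p.1 ^ 2 + p.2 ≠ 0} :=
  isOpen_ne_fun (by fun_prop) continuous_const

theorem profile_sum {m : ℕ} (x : Pt m) : (profile x).1 ^ 2 + (profile x).2 = ‖x‖ ^ 2 :=
  (norm_sq_eq_add x).symm

theorem profile_mem {m : ℕ} {x : Pt m} (hx : x ≠ 0) :
    profile x ∈ {p : ℝ × ℝ | p.1 ^ 2 + p.2 ≠ 0} := by
  rw [Set.mem_ofPred_eq, profile_sum]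
  exact pow_ne_zero _ (norm_ne_zero_iff.2 hx)

theorem gauss_div_complex {z : ℂ} (hz : z ≠ 0) :
    (Complex.exp (z ^ 2 / 2) / z).re = (invLeft + gaussLeft) 0 (z.re, z.im ^ 2) ∧
      (Complex.exp (z ^ 2 / 2) / z).im = z.im * (invRight + gaussRight) 0 (z.re, z.im ^ 2) := by
  have h : Complex.exp (z ^ 2 / 2) / z = z⁻¹ + (Complex.exp (z ^ 2 / 2) - 1) / z := by
    field_simp; ring
  rw [h, Complex.add_re, Complex.add_im, (gauss_complex hz).1, (gauss_complex hz).2,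
    Complex.inv_re, Complex.inv_im, Complex.normSq_apply]
  simp only [Pi.add_apply, invLeft, invRight]
  constructor
  · simp [div_eq_mul_inv, sq]
  · simp [div_eq_mul_inv, sq]; ring

theorem axial_gauss_div {m : ℕ} {x : Pt m} (hx : x ≠ 0) :
    axial (fun z => Complex.exp (z ^ 2 / 2) / z) x =
      axialField m ((invLeft + gaussLeft) 0) ((invRight + gaussRight) 0) x := by
  have hz : (⟨x 0, ‖vecPart x‖⟩ : ℂ) ≠ 0 := by
    intro h
    have h0 : x 0 = 0 := congrArg Complex.re h
    have h1 : ‖vecPart x‖ = 0 := congrArg Complex.im h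
    have := norm_sq_eq_add x
    rw [h0, h1] at this
    exact hx (norm_eq_zero.1 (by simpa using this))
  have h := gauss_div_complex hz
  rw [axial, axialField, h.1, h.2, Algebra.algebraMap_eq_smul_one]
  congr 1
  -- The unit vector ω carries a factor 1/r, which cancels the factor r in v = r b; on the axis both
  -- vector parts are zero.
  rcases eq_or_ne (vecPart x) 0 with h0 | h0
  · simp [h0]
  · have : ‖vecPart x‖ ≠ 0 := norm_ne_zero_iff.2 h0
    rw [map_smul, smul_smul]
    congr 1
    simp only [profile]
    field_simp

theorem gaussFt_eq_axialField {n : ℕ} {x : Pt (2 * n + 1)} (hx : x ≠ 0) :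
    gaussFt (2 * n + 1) x = ((2 * n).doubleFactorial : ℝ) •
      axialField (2 * n + 1) ((invLeft + gaussLeft) n) ((invRight + gaussRight) n) x := by
  rw [gaussFt, Ft, ← prod_range_sub_eq_doubleFactorial,
    ← fueterSystem_inv_add_gauss.iterate_laplacian_eq isOpen_inv_domain n
      (F := fun x : Pt (2 * n + 1) => axial (fun z => Complex.exp (z ^ 2 / 2) / z) x * 1)]
  · simp
  · intro y hy
    rw [mul_one, axial_gauss_div]
    rintro rfl
    simp [profile, vecPart, EuclideanSpace.norm_eq] at hy
  · exact profile_mem hx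

theorem axialField_inv {n : ℕ} (x : Pt (2 * n + 1)) :
    axialField (2 * n + 1) (invLeft n) (invRight n) x =
      ((-1) ^ n * ((2 * n).doubleFactorial : ℝ)) •
        ((‖x‖ ^ (2 * n + 1 + 1))⁻¹ • star (paravector x)) := by
  rw [star_paravector, axialField, invLeft, invRight, profile_sum, ← pow_mul,
    Nat.doubleFactorial_two_mul, show ‖x‖ ^ (2 * n + 1 + 1) = ‖x‖ ^ (2 * (n + 1)) from rfl]
  have h : ((-2 : ℝ)) ^ n = (-1) ^ n * 2 ^ n := by rw [← mul_pow]; norm_num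
  rw [h]
  simp only [profile]
  push_cast
  module

/-- The monogenic part of the Fueter image of `exp(z²/2)/z`. -/
def gaussMonogenic (n : ℕ) : Pt (2 * n + 1) → Cl (2 * n + 1) :=
  axialField (2 * n + 1)
    (fun p => ((-1) ^ n * ((2 * n).doubleFactorial : ℝ)⁻¹) * gaussLeft n p)
    (fun p => ((-1) ^ n * ((2 * n).doubleFactorial : ℝ)⁻¹) * gaussRight n p)

theorem contDiff_gaussMonogenic (n : ℕ) : ContDiff ℝ 1 (gaussMonogenic n) :=
  contDiff_iff_contDiffAt.2 fun _ =>
    (fueterSystem_gauss.const_smul _).contDiffAt_axialField isOpen_univ 1 n trivial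

theorem isEntireTwoSidedMonogenic_gaussMonogenic (n : ℕ) :
    IsEntireTwoSidedMonogenic (gaussMonogenic n) := by
  refine ⟨contDiff_gaussMonogenic n, fun x => ?_, fun x => ?_⟩
  · refine ((fueterSystem_gauss.const_smul _).crLeft_eq n trivial).trans ?_
    push_cast; simp
  · refine ((fueterSystem_gauss.const_smul _).crRight_eq n trivial).trans ?_
    push_cast; simp

theorem gaussFt_eq {n : ℕ} {x : Pt (2 * n + 1)} (hx : x ≠ 0) :
    gaussFt (2 * n + 1) x = ((-1 : ℝ) ^ n * ((2 * n).doubleFactorial : ℝ) ^ 2) •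
      ((‖x‖ ^ (2 * n + 1 + 1))⁻¹ • star (paravector x) + gaussMonogenic n x) := by
  have hD : ((2 * n).doubleFactorial : ℝ) ≠ 0 := by
    exact_mod_cast (Nat.doubleFactorial_pos _).ne'
  have h1 : axialField (2 * n + 1) ((invLeft + gaussLeft) n) ((invRight + gaussRight) n) x =
      axialField (2 * n + 1) (invLeft n) (invRight n) x +
        axialField (2 * n + 1) (gaussLeft n) (gaussRight n) x := by
    simp only [axialField, Pi.add_apply]; module
  have h2 : gaussMonogenic n x = ((-1) ^ n * ((2 * n).doubleFactorial : ℝ)⁻¹) •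
      axialField (2 * n + 1) (gaussLeft n) (gaussRight n) x := by
    simp only [gaussMonogenic, axialField]; module
  rw [gaussFt_eq_axialField hx, h1, axialField_inv, h2, smul_add, smul_add, smul_smul _ _
    (axialField (2 * n + 1) (gaussLeft n) (gaussRight n) x)]
  -- One factor (2n)!! comes from the iterated Laplacian, the second from the n-th field of 1/z. The
  -- entire part carries only the first, hence the inverse (2n)!! in `gaussMonogenic`.
  have h3 : ((-1 : ℝ) ^ n * ((2 * n).doubleFactorial : ℝ) ^ 2) *
      ((-1) ^ n * ((2 * n).doubleFactorial : ℝ)⁻¹) = (2 * n).doubleFactorial := by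
    have : ((-1 : ℝ)) ^ n * (-1) ^ n = 1 := by rw [← mul_pow]; simp
    field_simp
    linear_combination this
  rw [h3, smul_smul]
  congr 2
  ring

/-! ### Decay -/

/-- The polynomials in `1/z`, `z/y` and `1/y`, where `y` is the imaginary part of `z`. -/
inductive IsStripPolynomial : (ℂ → ℂ) → Prop
  | const (c : ℂ) : IsStripPolynomial fun _ => c
  | inv : IsStripPolynomial fun z => z⁻¹
  | ratio : IsStripPolynomial fun z => z * (z.im : ℂ)⁻¹
  | invIm : IsStripPolynomial fun z => (z.im : ℂ)⁻¹
  | add {P Q : ℂ → ℂ} : IsStripPolynomial P → IsStripPolynomial Q →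
      IsStripPolynomial fun z => P z + Q z
  | mul {P Q : ℂ → ℂ} : IsStripPolynomial P → IsStripPolynomial Q →
      IsStripPolynomial fun z => P z * Q z

theorem hasDerivAt_mk (x r : ℝ) : HasDerivAt (fun ρ : ℝ => (⟨x, ρ⟩ : ℂ)) Complex.I r := by
  have h : (fun ρ : ℝ => (⟨x, ρ⟩ : ℂ)) = fun ρ : ℝ => (x : ℂ) + ρ * Complex.I := by
    ext ρ; rw [Complex.mk_eq_add_mul_I]
  rw [h]
  simpa using ((Complex.ofRealCLM.hasDerivAt (x := r)).mul_const Complex.I).const_add (x : ℂ)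

namespace IsStripPolynomial

/-- The class is stable under `(1/y) ∂_y`. -/
theorem exists_hasDerivAt {P : ℂ → ℂ} (hP : IsStripPolynomial P) :
    ∃ P', IsStripPolynomial P' ∧ ∀ x r : ℝ, 0 < r →
      HasDerivAt (fun ρ : ℝ => P ⟨x, ρ⟩) (r * P' ⟨x, r⟩) r := by
  have hne : ∀ x r : ℝ, 0 < r → (⟨x, r⟩ : ℂ) ≠ 0 := fun x r hr h =>
    hr.ne' (congrArg Complex.im h)
  have him : ∀ x r : ℝ, 0 < r → HasDerivAt (fun ρ : ℝ => ((ρ : ℝ) : ℂ)⁻¹) (-(r : ℂ)⁻¹ ^ 2) r := by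
    intro x r hr
    have hr' : (r : ℂ) ≠ 0 := by exact_mod_cast hr.ne'
    refine ((Complex.ofRealCLM.hasDerivAt (x := r)).inv hr').congr_deriv ?_
    simp [neg_div]
  induction hP with
  | const c => exact ⟨_, const 0, fun x r _ => by simpa using hasDerivAt_const r c⟩
  | inv =>
    refine ⟨_, mul (const (-Complex.I)) (mul invIm (mul inv inv)), fun x r hr => ?_⟩
    have hr' : (r : ℂ) ≠ 0 := by exact_mod_cast hr.ne'
    refine ((hasDerivAt_mk x r).inv (hne x r hr)).congr_deriv ?_
    have := hne x r hr
    field_simp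
  | ratio =>
    refine ⟨_, add (mul (const Complex.I) (mul invIm invIm))
      (mul (const (-1)) (mul (mul ratio invIm) invIm)), fun x r hr => ?_⟩
    have hr' : (r : ℂ) ≠ 0 := by exact_mod_cast hr.ne'
    refine ((hasDerivAt_mk x r).mul (him x r hr)).congr_deriv ?_
    field_simp
  | invIm =>
    refine ⟨_, mul (const (-1)) (mul invIm (mul invIm invIm)), fun x r hr => ?_⟩
    have hr' : (r : ℂ) ≠ 0 := by exact_mod_cast hr.ne'
    refine (him x r hr).congr_deriv ?_
    field_simp
  | add _ _ hP hQ =>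
    obtain ⟨P', hP', h1⟩ := hP
    obtain ⟨Q', hQ', h2⟩ := hQ
    exact ⟨_, add hP' hQ', fun x r hr => ((h1 x r hr).add (h2 x r hr)).congr_deriv (by ring)⟩
  | mul hp hq hP hQ =>
    obtain ⟨P', hP', h1⟩ := hP
    obtain ⟨Q', hQ', h2⟩ := hQ
    exact ⟨_, add (mul hP' hq) (mul hp hQ'),
      fun x r hr => ((h1 x r hr).mul (h2 x r hr)).congr_deriv (by ring)⟩

/-- It suffices to bound the generators: 1/z and 1/y by 1/R, and z/y by K/R + 1. -/
theorem bounded {P : ℂ → ℂ} (hP : IsStripPolynomial P) {K R : ℝ} (hK : 0 < K) (hR : 0 < R) :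
    ∃ C, 0 ≤ C ∧ ∀ z : ℂ, |z.re| ≤ K → R ≤ z.im → ‖P z‖ ≤ C := by
  have hi : ∀ z : ℂ, R ≤ z.im → ‖(z.im : ℂ)⁻¹‖ ≤ R⁻¹ := by
    intro z hz
    rw [norm_inv, Complex.norm_real, Real.norm_of_nonneg (hR.le.trans hz)]
    exact inv_anti₀ hR hz
  induction hP with
  | const c => exact ⟨‖c‖, norm_nonneg _, fun z _ _ => le_rfl⟩
  | inv =>
    refine ⟨R⁻¹, by positivity, fun z _ hz => ?_⟩
    rw [norm_inv]
    exact inv_anti₀ hR (hz.trans ((le_abs_self _).trans (Complex.abs_im_le_norm z)))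
  | ratio =>
    refine ⟨K * R⁻¹ + 1, by positivity, fun z hz hz' => ?_⟩
    have hpos : 0 < z.im := hR.trans_le hz'
    have h1 : ‖z‖ ≤ K + z.im := by
      refine (Complex.norm_le_abs_re_add_abs_im z).trans ?_
      rw [abs_of_pos hpos]
      linarith
    have h2 := hi z hz'
    rw [norm_mul]
    calc ‖z‖ * ‖(z.im : ℂ)⁻¹‖ ≤ (K + z.im) * ‖(z.im : ℂ)⁻¹‖ := by gcongr
      _ = K * ‖(z.im : ℂ)⁻¹‖ + z.im * z.im⁻¹ := by
        rw [add_mul, norm_inv, Complex.norm_real, Real.norm_of_nonneg hpos.le]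
      _ ≤ K * R⁻¹ + 1 := by
        rw [mul_inv_cancel₀ hpos.ne']
        gcongr
  | invIm => exact ⟨R⁻¹, by positivity, fun z _ hz => hi z hz⟩
  | add _ _ hP hQ =>
    obtain ⟨C, hC, h1⟩ := hP
    obtain ⟨D, hD, h2⟩ := hQ
    exact ⟨C + D, by positivity, fun z hz hz' =>
      (norm_add_le _ _).trans (add_le_add (h1 z hz hz') (h2 z hz hz'))⟩
  | mul _ _ hP hQ =>
    obtain ⟨C, hC, h1⟩ := hP
    obtain ⟨D, hD, h2⟩ := hQ
    refine ⟨C * D, by positivity, fun z hz hz' => ?_⟩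
    rw [norm_mul]
    exact mul_le_mul (h1 z hz hz') (h2 z hz hz') (norm_nonneg _) hC

/-- `(1/y) ∂_y` of `exp(z²/2) P`. -/
theorem exists_hasDerivAt_exp {P : ℂ → ℂ} (hP : IsStripPolynomial P) :
    ∃ P', IsStripPolynomial P' ∧ ∀ x r : ℝ, 0 < r →
      HasDerivAt (fun ρ : ℝ => Complex.exp ((⟨x, ρ⟩ : ℂ) ^ 2 / 2) * P ⟨x, ρ⟩)
        (r * (Complex.exp ((⟨x, r⟩ : ℂ) ^ 2 / 2) * P' ⟨x, r⟩)) r := by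
  obtain ⟨P', hP', h⟩ := hP.exists_hasDerivAt
  -- Differentiating the exponential in y brings down i z, so (1/y)∂_y produces the factor i z/y;
  -- this is why z/y is among the generators.
  refine ⟨_, add (mul (mul (const Complex.I) ratio) hP) hP', fun x r hr => ?_⟩
  have hr' : (r : ℂ) ≠ 0 := by exact_mod_cast hr.ne'
  have h1 := (((hasDerivAt_mk x r).pow 2).div_const 2).cexp
  refine (h1.mul (h x r hr)).congr_deriv ?_
  field_simp
  simp
  ring

end IsStripPolynomial

/-- This is the chain rule 2∂_s = (1/r)∂_r, which links the system to differentiation in the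
imaginary part of z. -/
theorem FueterSystem.hasDerivAt_sq {Ω : Set (ℝ × ℝ)} {a b : ℕ → ℝ × ℝ → ℝ}
    (h : FueterSystem Ω a b) (k : ℕ) {x r : ℝ} (hx : (x, r ^ 2) ∈ Ω) :
    HasDerivAt (fun ρ : ℝ => a k (x, ρ ^ 2)) (r * a (k + 1) (x, r ^ 2)) r ∧
      HasDerivAt (fun ρ : ℝ => b k (x, ρ ^ 2)) (r * b (k + 1) (x, r ^ 2)) r := by
  have hc : HasDerivAt (fun ρ : ℝ => (x, ρ ^ 2)) (0, 2 * r) r := by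
    simpa using (hasDerivAt_const r x).prodMk (hasDerivAt_pow 2 r)
  constructor
  · refine ((h.1 k _ hx).comp_hasDerivAt r hc).congr_deriv ?_
    simp; ring
  · refine ((h.2 k _ hx).comp_hasDerivAt r hc).congr_deriv ?_
    simp; ring

/-- Induction on k, comparing two expressions for the same r-derivative. Keeping r b_k instead of
b_k matches the imaginary part at k = 0 and the size of the vector part in the decay estimate. -/
theorem exists_isStripPolynomial (k : ℕ) :
    ∃ P Q, IsStripPolynomial P ∧ IsStripPolynomial Q ∧ ∀ x r : ℝ, 0 < r →
      (invLeft + gaussLeft) k (x, r ^ 2) =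
        (Complex.exp ((⟨x, r⟩ : ℂ) ^ 2 / 2) * P ⟨x, r⟩).re ∧
      r * (invRight + gaussRight) k (x, r ^ 2) =
        (Complex.exp ((⟨x, r⟩ : ℂ) ^ 2 / 2) * Q ⟨x, r⟩).im := by
  induction k with
  | zero =>
    refine ⟨_, _, .inv, .inv, fun x r hr => ?_⟩
    have h := gauss_div_complex (z := ⟨x, r⟩) fun h => hr.ne' (congrArg Complex.im h)
    exact ⟨h.1.symm, h.2.symm⟩
  | succ k ih =>
    obtain ⟨P, Q, hP, hQ, h⟩ := ih
    obtain ⟨P', hP', hp⟩ := hP.exists_hasDerivAt_exp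
    obtain ⟨Q', hQ', hq⟩ := hQ.exists_hasDerivAt_exp
    -- Differentiating r b_k gives b_k + r² b_{k+1}, so r b_{k+1} = (1/r)∂_r (r b_k) - (r b_k)/r².
    -- The new Q is therefore Q' - Q/y².
    refine ⟨_, _, hP', .add hQ' (.mul (.const (-1)) (.mul hQ (.mul .invIm .invIm))),
      fun x r hr => ?_⟩
    have hmem : (x, r ^ 2) ∈ {p : ℝ × ℝ | p.1 ^ 2 + p.2 ≠ 0} := by
      simp only [Set.mem_ofPred_eq]; positivity
    obtain ⟨ha, hb⟩ := fueterSystem_inv_add_gauss.hasDerivAt_sq k hmem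
    have hev : ∀ᶠ ρ in nhds r, 0 < ρ := lt_mem_nhds hr
    have ha' := ha.unique ((Complex.reCLM.hasFDerivAt.comp_hasDerivAt r
      (hp x r hr)).congr_of_eventuallyEq (by
        filter_upwards [hev] with ρ hρ using (h x ρ hρ).1))
    have hb' := ((hasDerivAt_id r).mul hb).unique ((Complex.imCLM.hasFDerivAt.comp_hasDerivAt r
      (hq x r hr)).congr_of_eventuallyEq (by
        filter_upwards [hev] with ρ hρ using (h x ρ hρ).2))
    have h2 := (h x r hr).2
    constructor
    · apply mul_left_cancel₀ hr.ne'
      rw [ha']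
      simp
    · have e1 : (Complex.exp ((⟨x, r⟩ : ℂ) ^ 2 / 2) * (-1 * (Q ⟨x, r⟩ * ((r : ℂ)⁻¹ * (r : ℂ)⁻¹)))).im
          = -(r⁻¹ * r⁻¹ * (Complex.exp ((⟨x, r⟩ : ℂ) ^ 2 / 2) * Q ⟨x, r⟩).im) := by
        rw [show Complex.exp ((⟨x, r⟩ : ℂ) ^ 2 / 2) * (-1 * (Q ⟨x, r⟩ * ((r : ℂ)⁻¹ * (r : ℂ)⁻¹))) =
          ((-(r⁻¹ * r⁻¹) : ℝ) : ℂ) * (Complex.exp ((⟨x, r⟩ : ℂ) ^ 2 / 2) * Q ⟨x, r⟩) by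
            push_cast; ring, Complex.im_ofReal_mul]
        ring
      have e2 : (invRight + gaussRight) k (x, r ^ 2) +
          r * (r * (invRight + gaussRight) (k + 1) (x, r ^ 2)) =
          r * (Complex.exp ((⟨x, r⟩ : ℂ) ^ 2 / 2) * Q' ⟨x, r⟩).im := by
        rw [← Complex.im_ofReal_mul]
        simpa using hb'
      rw [mul_add, Complex.add_im, e1, ← h2]
      field_simp
      linear_combination e2

theorem gaussFt_decay (n : ℕ) {K R : ℝ} (hK : 0 < K) (hR : 0 < R) :
    ∃ C : ℝ, 0 < C ∧ ∀ x : Pt (2 * n + 1), |x 0| ≤ K → R ≤ ‖vecPart x‖ →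
      ‖gaussFt (2 * n + 1) x‖ ≤ C * Real.exp (-‖vecPart x‖ ^ 2 / 2) := by
  obtain ⟨P, Q, hP, hQ, h⟩ := exists_isStripPolynomial n
  obtain ⟨C, hC, hPC⟩ := hP.bounded hK hR
  obtain ⟨D, hD, hQD⟩ := hQ.bounded hK hR
  set N := ‖vecL (2 * n + 1)‖
  -- The bounds C and D are only known to be nonnegative; the added 1 makes the constant positive.
  refine ⟨(2 * n).doubleFactorial * (Real.exp (K ^ 2 / 2) * (C * ‖(1 : Cl (2 * n + 1))‖ + D * N)) + 1,
    by positivity, fun x hx hx' => ?_⟩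
  set r := ‖vecPart x‖ with hr
  have hr0 : 0 < r := hR.trans_le hx'
  have hx0 : x ≠ 0 := by
    rintro rfl
    have : vecPart (0 : Pt (2 * n + 1)) = 0 := rfl
    simp [this] at hr
    exact hr0.ne' hr
  have hexp : ‖Complex.exp ((⟨x 0, r⟩ : ℂ) ^ 2 / 2)‖ ≤ Real.exp (K ^ 2 / 2) * Real.exp (-r ^ 2 / 2) := by
    rw [Complex.norm_exp, ← Real.exp_add, Real.exp_le_exp]
    have : (x 0) ^ 2 ≤ K ^ 2 := sq_le_sq' (neg_le_of_abs_le hx) (le_of_abs_le hx)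
    have e : ((⟨x 0, r⟩ : ℂ) ^ 2 / 2).re = (x 0 ^ 2 - r ^ 2) / 2 := by
      rw [show (2 : ℂ) = ((2 : ℝ) : ℂ) by norm_num, Complex.div_ofReal_re, sq, Complex.mul_re]
      ring
    rw [e]
    linarith
  have h1 : |(invLeft + gaussLeft) n (profile x)| ≤
      Real.exp (K ^ 2 / 2) * Real.exp (-r ^ 2 / 2) * C := by
    rw [profile, (h (x 0) r hr0).1]
    refine (Complex.abs_re_le_norm _).trans ?_
    rw [norm_mul]
    exact mul_le_mul hexp (hPC _ hx hx') (norm_nonneg _) (by positivity)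
  have h2 : |(invRight + gaussRight) n (profile x)| * r ≤
      Real.exp (K ^ 2 / 2) * Real.exp (-r ^ 2 / 2) * D := by
    rw [← abs_of_pos hr0, ← abs_mul, mul_comm, profile, abs_of_pos hr0, (h (x 0) r hr0).2]
    refine (Complex.abs_im_le_norm _).trans ?_
    rw [norm_mul]
    exact mul_le_mul hexp (hQD _ hx hx') (norm_nonneg _) (by positivity)
  have h3 : ‖vec (2 * n + 1) (vecPart x)‖ ≤ N * r := (vecL (2 * n + 1)).le_opNorm _
  have h4 : ‖axialField (2 * n + 1) ((invLeft + gaussLeft) n) ((invRight + gaussRight) n) x‖ ≤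
      Real.exp (K ^ 2 / 2) * (C * ‖(1 : Cl (2 * n + 1))‖ + D * N) * Real.exp (-r ^ 2 / 2) := by
    rw [axialField]
    refine (norm_add_le _ _).trans ?_
    rw [norm_smul, norm_smul, Real.norm_eq_abs, Real.norm_eq_abs]
    have h5 : |(invLeft + gaussLeft) n (profile x)| * ‖(1 : Cl (2 * n + 1))‖ ≤
      Real.exp (K ^ 2 / 2) * Real.exp (-r ^ 2 / 2) * C * ‖(1 : Cl (2 * n + 1))‖ := by gcongr
    have h6 : |(invRight + gaussRight) n (profile x)| * ‖vec (2 * n + 1) (vecPart x)‖ ≤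
        Real.exp (K ^ 2 / 2) * Real.exp (-r ^ 2 / 2) * D * N := by
      calc _ ≤ |(invRight + gaussRight) n (profile x)| * (N * r) := by gcongr
        _ = (|(invRight + gaussRight) n (profile x)| * r) * N := by ring
        _ ≤ _ := by gcongr
    linarith
  rw [gaussFt_eq_axialField hx0, norm_smul, Real.norm_of_nonneg (by positivity)]
  calc _ ≤ ((2 * n).doubleFactorial : ℝ) * (Real.exp (K ^ 2 / 2) *
        (C * ‖(1 : Cl (2 * n + 1))‖ + D * N) * Real.exp (-r ^ 2 / 2)) := by gcongr
    _ ≤ _ := by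
      rw [add_mul]
      have := Real.exp_pos (-r ^ 2 / 2)
      linarith

/-! ### Integration by parts against test functions. -/

open MeasureTheory Filter Topology

section
variable {m : ℕ}

theorem continuous_pderiv {V : Type*} [NormedAddCommGroup V] [NormedSpace ℝ V] {F : Pt m → V}
    (hF : ContDiff ℝ 1 F) (j : Fin (m + 1)) : Continuous (pderiv j F) :=
  (hF.continuous_fderiv (by norm_num)).clm_apply continuous_const

theorem hasCompactSupport_pderiv {φ : Pt m → ℝ} (hφ : HasCompactSupport φ) (j : Fin (m + 1)) :
    HasCompactSupport (pderiv j φ) :=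
  hφ.fderiv_apply (𝕜 := ℝ) _

/-- Integration by parts for first order operators `∑ T_j ∂_j` with constant coefficients. -/
theorem neg_integral_sum_pderiv_smul {φ : Pt m → ℝ} (hφ : ContDiff ℝ 1 φ)
    (hφc : HasCompactSupport φ) {F : Pt m → Cl m} (hF : ContDiff ℝ 1 F)
    (T : Fin (m + 1) → Cl m →L[ℝ] Cl m) :
    (-∫ x, ∑ j, pderiv j φ x • T j (F x)) = ∫ x, φ x • ∑ j, T j (pderiv j F x) := by
  have hTF : ∀ j, ContDiff ℝ 1 fun x => T j (F x) := fun j => (T j).contDiff.comp hF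
  have hp : ∀ j x, pderiv j (fun y => T j (F y)) x = T j (pderiv j F x) := by
    intro j x
    have := ((T j).hasFDerivAt.comp x (hF.differentiable (by norm_num) x).hasFDerivAt).fderiv
    rw [pderiv, pderiv, show (fun y => T j (F y)) = T j ∘ F from rfl, this]
    rfl
  have h1 : ∀ j, Integrable fun x => pderiv j φ x • T j (F x) := fun j =>
    ((continuous_pderiv hφ j).smul (hTF j).continuous).integrable_of_hasCompactSupport
      (hasCompactSupport_pderiv hφc j).smul_right
  have h2 : ∀ j, Integrable fun x => φ x • pderiv j (fun y => T j (F y)) x := fun j =>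
    (hφ.continuous.smul (continuous_pderiv (hTF j) j)).integrable_of_hasCompactSupport
      hφc.smul_right
  have h3 : ∀ j, Integrable fun x => φ x • T j (F x) := fun j =>
    (hφ.continuous.smul (hTF j).continuous).integrable_of_hasCompactSupport hφc.smul_right
  have key : ∀ j, ∫ x, φ x • pderiv j (fun y => T j (F y)) x =
      -∫ x, pderiv j φ x • T j (F x) := fun j =>
    integral_smul_fderiv_eq_neg_fderiv_smul_of_integrable (h1 j) (h2 j) (h3 j)
      (fun x _ => hφ.differentiable (by norm_num) x)
      (fun x _ => (hTF j).differentiable (by norm_num) x)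
  rw [integral_finsetSum _ fun j _ => h1 j]
  simp only [Finset.smul_sum, ← hp]
  rw [integral_finsetSum _ fun j _ => h2 j, ← Finset.sum_neg_distrib]
  exact Finset.sum_congr rfl fun j _ => (key j).symm

end

/-! ### The regularized Cauchy kernel and the fundamental solution. -/

/-- The conjugation `x ↦ x̄` on paravectors. -/
def conjL (m : ℕ) : Pt m →L[ℝ] Cl m :=
  (EuclideanSpace.proj (0 : Fin (m + 1)) : Pt m →L[ℝ] ℝ).smulRight (1 : Cl m) -
    (vecL m).comp (vecPartL m)

theorem conjL_apply {m : ℕ} (x : Pt m) : conjL m x = star (paravector x) := by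
  rw [star_paravector]; simp [conjL]

/-- The regularized Cauchy kernel `x̄ / (|x|² + ε²)^(n+1)`. -/
def regKernel (n : ℕ) (ε : ℝ) (x : Pt (2 * n + 1)) : Cl (2 * n + 1) :=
  ((‖x‖ ^ 2 + ε ^ 2) ^ (n + 1))⁻¹ • conjL (2 * n + 1) x

/-- The divergence of the regularized Cauchy kernel. -/
def regDelta (n : ℕ) (ε : ℝ) (x : Pt (2 * n + 1)) : ℝ :=
  2 * (n + 1) * ε ^ 2 * ((‖x‖ ^ 2 + ε ^ 2) ^ (n + 2))⁻¹

section
variable {n : ℕ}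

theorem contDiff_regKernel {ε : ℝ} (hε : 0 < ε) : ContDiff ℝ 1 (regKernel n ε) := by
  have h : ContDiff ℝ 1 fun x : Pt (2 * n + 1) => ((‖x‖ ^ 2 + ε ^ 2) ^ (n + 1))⁻¹ :=
    (((contDiff_norm_sq ℝ).add contDiff_const).pow _).inv fun x => by positivity
  exact h.smul (conjL (2 * n + 1)).contDiff

theorem regKernel_eq_axialField (ε : ℝ) : regKernel n ε = axialField (2 * n + 1)
    (fun p => p.1 * ((p.1 ^ 2 + p.2 + ε ^ 2) ^ (n + 1))⁻¹)
    (fun p => -((p.1 ^ 2 + p.2 + ε ^ 2) ^ (n + 1))⁻¹) := by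
  ext1 x
  rw [regKernel, axialField, profile_sum, conjL_apply, star_paravector, profile]
  module

theorem hasFDerivAt_regKernel_parts {ε : ℝ} (hε : 0 < ε) {p : ℝ × ℝ} (hp : 0 ≤ p.2) :
    HasFDerivAt (fun p : ℝ × ℝ => p.1 * ((p.1 ^ 2 + p.2 + ε ^ 2) ^ (n + 1))⁻¹)
      ((((p.1 ^ 2 + p.2 + ε ^ 2) ^ (n + 1))⁻¹ -
          2 * (n + 1) * p.1 ^ 2 * ((p.1 ^ 2 + p.2 + ε ^ 2) ^ (n + 2))⁻¹) •
          ContinuousLinearMap.fst ℝ ℝ ℝ +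
        (-(n + 1) * p.1 * ((p.1 ^ 2 + p.2 + ε ^ 2) ^ (n + 2))⁻¹) •
          ContinuousLinearMap.snd ℝ ℝ ℝ) p ∧
    HasFDerivAt (fun p : ℝ × ℝ => -((p.1 ^ 2 + p.2 + ε ^ 2) ^ (n + 1))⁻¹)
      ((2 * (n + 1) * p.1 * ((p.1 ^ 2 + p.2 + ε ^ 2) ^ (n + 2))⁻¹) •
          ContinuousLinearMap.fst ℝ ℝ ℝ +
        ((n + 1) * ((p.1 ^ 2 + p.2 + ε ^ 2) ^ (n + 2))⁻¹) • ContinuousLinearMap.snd ℝ ℝ ℝ) p := by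
  have hρ : p.1 ^ 2 + p.2 + ε ^ 2 ≠ 0 := by positivity
  have h1 : HasFDerivAt (fun p : ℝ × ℝ => p.1 ^ 2 + p.2 + ε ^ 2)
      ((2 * p.1) • ContinuousLinearMap.fst ℝ ℝ ℝ + ContinuousLinearMap.snd ℝ ℝ ℝ) p := by
    refine ((((ContinuousLinearMap.fst ℝ ℝ ℝ).hasFDerivAt.pow 2).add
      (ContinuousLinearMap.snd ℝ ℝ ℝ).hasFDerivAt).add_const _).congr_fderiv ?_
    ext <;> simp
  have h2 : HasFDerivAt (fun p : ℝ × ℝ => ((p.1 ^ 2 + p.2 + ε ^ 2) ^ (n + 1))⁻¹)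
      ((-(n + 1) * ((p.1 ^ 2 + p.2 + ε ^ 2) ^ (n + 2))⁻¹) •
        ((2 * p.1) • ContinuousLinearMap.fst ℝ ℝ ℝ + ContinuousLinearMap.snd ℝ ℝ ℝ)) p := by
    refine (((hasDerivAt_pow (n + 1) (p.1 ^ 2 + p.2 + ε ^ 2)).inv (pow_ne_zero _ hρ)).comp_hasFDerivAt p
      h1).congr_fderiv ?_
    congr 1
    push_cast
    field_simp
    simp
    ring
  constructor
  · refine ((ContinuousLinearMap.fst ℝ ℝ ℝ).hasFDerivAt.mul h2).congr_fderiv ?_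
    ext
    · simp; ring
    · simp; ring
  · refine h2.neg.congr_fderiv ?_
    ext
    · simp; ring
    · simp; ring

/-- With ρ = |x|² + ε² the scalar part is 2(n + 1) ρ^{-(n+2)} (ρ - |x|²), and the vector part
cancels. -/
theorem crLeft_regKernel {ε : ℝ} (hε : 0 < ε) (x : Pt (2 * n + 1)) :
    crLeft (regKernel n ε) x = regDelta n ε x • (1 : Cl (2 * n + 1)) ∧
      crRight (regKernel n ε) x = regDelta n ε x • (1 : Cl (2 * n + 1)) := by
  have hp : 0 ≤ (profile x).2 := by simp only [profile]; positivity
  obtain ⟨ha, hb⟩ := hasFDerivAt_regKernel_parts (n := n) hε hp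
  rw [regKernel_eq_axialField, crLeft_axialField ha hb, crRight_axialField ha hb, and_self,
    regDelta, ← profile_sum]
  have hρ : (profile x).1 ^ 2 + (profile x).2 + ε ^ 2 ≠ 0 := by positivity
  have h : ∀ {a b c : ℝ}, a = c → b = 0 →
      a • (1 : Cl (2 * n + 1)) + b • vec (2 * n + 1) (vecPart x) = c • 1 := by
    rintro a b c rfl rfl; simp
  apply h
  · push_cast
    field_simp
    ring
  · ring

/-- A bound independent of ε, valid also at ε = 0: it serves as the dominating function in the limit
and gives local integrability of the Cauchy kernel. -/
theorem norm_regKernel_le (ε : ℝ) (x : Pt (2 * n + 1)) :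
    ‖regKernel n ε x‖ ≤ ‖conjL (2 * n + 1)‖ * (‖x‖ ^ (2 * n + 1))⁻¹ := by
  rcases eq_or_ne x 0 with rfl | hx
  · simp [regKernel]
  · have hx' : 0 < ‖x‖ := norm_pos_iff.2 hx
    rw [regKernel, norm_smul, Real.norm_of_nonneg (by positivity)]
    have h1 : ((‖x‖ ^ 2 + ε ^ 2) ^ (n + 1))⁻¹ ≤ ((‖x‖ ^ 2) ^ (n + 1))⁻¹ := by
      gcongr
      nlinarith [sq_nonneg ε]
    calc _ ≤ ((‖x‖ ^ 2) ^ (n + 1))⁻¹ * (‖conjL (2 * n + 1)‖ * ‖x‖) := by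
          gcongr
          exact (conjL (2 * n + 1)).le_opNorm x
      _ = _ := by
          rw [← pow_mul, show ‖x‖ ^ (2 * (n + 1)) = ‖x‖ ^ (2 * n + 1) * ‖x‖ from
            pow_succ ‖x‖ (2 * n + 1)]
          field_simp

theorem locallyIntegrable_norm_pow_inv (m : ℕ) :
    LocallyIntegrable fun x : Pt m => (‖x‖ ^ m)⁻¹ := by
  intro x
  refine ⟨Metric.ball 0 (‖x‖ + 1), Metric.isOpen_ball.mem_nhds (by simp), ?_⟩
  -- In polar coordinates on ℝ^(m+1) the Jacobian is y^m and cancels the singularity.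
  refine (integrableOn_fun_norm_addHaar (f := fun y => (y ^ m)⁻¹) volume).2 ?_
  refine IntegrableOn.congr_fun (f := fun _ => (1 : ℝ)) (by simp) (fun y hy => ?_)
    measurableSet_Ioo
  have : y ^ m ≠ 0 := pow_ne_zero _ hy.1.ne'
  simp [this]

theorem aestronglyMeasurable_regKernel (ε : ℝ) :
    AEStronglyMeasurable (regKernel n ε) volume := by
  have h : Measurable fun x : Pt (2 * n + 1) => ((‖x‖ ^ 2 + ε ^ 2) ^ (n + 1))⁻¹ := by fun_prop
  exact h.aestronglyMeasurable.smul (conjL (2 * n + 1)).continuous.aestronglyMeasurable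

theorem locallyIntegrable_regKernel (ε : ℝ) : LocallyIntegrable (regKernel n ε) := by
  refine ((locallyIntegrable_norm_pow_inv (2 * n + 1)).smul ‖conjL (2 * n + 1)‖).mono
    (aestronglyMeasurable_regKernel ε) (Eventually.of_forall fun x => ?_)
  refine (norm_regKernel_le ε x).trans (le_of_eq ?_)
  simp

theorem tendsto_regKernel {ι : Type*} {l : Filter ι} {δ : ι → ℝ} (hδ : Tendsto δ l (𝓝 0))
    (x : Pt (2 * n + 1)) : Tendsto (fun i => regKernel n (δ i) x) l (𝓝 (regKernel n 0 x)) := by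
  rcases eq_or_ne x 0 with rfl | hx
  · simpa [regKernel] using tendsto_const_nhds
  · have hx' : 0 < ‖x‖ := norm_pos_iff.2 hx
    have h : Tendsto (fun i => ((‖x‖ ^ 2 + δ i ^ 2) ^ (n + 1))⁻¹) l
        (𝓝 ((‖x‖ ^ 2 + 0 ^ 2) ^ (n + 1))⁻¹) :=
      (((hδ.pow 2).const_add _).pow _).inv₀ (by positivity)
    exact h.smul_const _

/-- The total mass of the divergence of the regularized Cauchy kernels. -/
def cauchyMass (n : ℕ) : ℝ := ∫ x, regDelta n 1 x

theorem integrable_regDelta_one : Integrable (regDelta n 1) := by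
  -- The decay exponent 2n + 4 exceeds the dimension 2n + 2.
  have h := integrable_rpow_neg_one_add_norm_sq (E := Pt (2 * n + 1)) (μ := volume)
    (r := 2 * n + 4) (by simp; linarith)
  refine (h.const_mul (2 * (n + 1))).congr (Eventually.of_forall fun x => ?_)
  have h1 : -(2 * (n : ℝ) + 4) / 2 = -((n + 2 : ℕ) : ℝ) := by push_cast; ring
  simp only [regDelta]
  rw [h1, Real.rpow_neg (by positivity), Real.rpow_natCast]
  ring

theorem cauchyMass_pos : 0 < cauchyMass n := by
  have hpos : ∀ x : Pt (2 * n + 1), 0 < regDelta n 1 x := fun x => by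
    unfold regDelta; positivity
  refine (integral_pos_iff_support_of_nonneg (fun x => (hpos x).le) integrable_regDelta_one).2 ?_
  have : Function.support (regDelta n 1) = Set.univ :=
    Set.eq_univ_of_forall fun x => (hpos x).ne'
  rw [this]
  exact Measure.measure_univ_pos.2 (NeZero.ne volume)

/-- Substituting x ↦ εx uses that the density scales as an approximate identity in dimension 2n + 2.
The ε-dependence moves into the test function, so that φ(εx) → φ(0) gives the limit by dominated
convergence. -/
theorem integral_smul_regDelta {φ : Pt (2 * n + 1) → ℝ} {ε : ℝ} (hε : 0 < ε) :
    ∫ x, φ x * regDelta n ε x = ∫ x, φ (ε • x) * regDelta n 1 x := by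
  have h := Measure.integral_comp_smul_of_nonneg (volume : Measure (Pt (2 * n + 1)))
    (fun x => φ x * (ε ^ (2 * n + 2) * regDelta n ε x)) ε (hR := hε.le)
  have h1 : ∀ x : Pt (2 * n + 1), ε ^ (2 * n + 2) * regDelta n ε (ε • x) = regDelta n 1 x := by
    intro x
    simp only [regDelta, norm_smul, Real.norm_of_nonneg hε.le]
    rw [show (ε * ‖x‖) ^ 2 + ε ^ 2 = ε ^ 2 * (‖x‖ ^ 2 + 1 ^ 2) by ring, mul_pow]
    field_simp
    ring
  simp only [h1] at h
  rw [h, finrank_euclideanSpace_fin]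
  have h2 : (fun x => φ x * (ε ^ (2 * n + 2) * regDelta n ε x)) =
      fun x => ε ^ (2 * n + 2) * (φ x * regDelta n ε x) := by ext x; ring
  rw [h2, integral_const_mul, smul_eq_mul, ← mul_assoc, inv_mul_cancel₀ (by positivity), one_mul]

theorem tendsto_integral_regDelta {φ : Pt (2 * n + 1) → ℝ} (hφ : Continuous φ)
    (hφc : HasCompactSupport φ) {δ : ℕ → ℝ} (hδ : Tendsto δ atTop (𝓝 0)) (hpos : ∀ i, 0 < δ i) :
    Tendsto (fun i => ∫ x, φ x * regDelta n (δ i) x) atTop (𝓝 (φ 0 * cauchyMass n)) := by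
  obtain ⟨C, hC⟩ := hφ.bounded_above_of_compact_support hφc
  simp only [integral_smul_regDelta (hpos _)]
  rw [cauchyMass, ← integral_const_mul]
  refine tendsto_integral_of_dominated_convergence (fun x => C * regDelta n 1 x) (fun i => ?_)
    (integrable_regDelta_one.const_mul C) (fun i => Eventually.of_forall fun x => ?_)
    (Eventually.of_forall fun x => ?_)
  · exact (hφ.comp (continuous_const_smul _)).aestronglyMeasurable.mul
      integrable_regDelta_one.aestronglyMeasurable
  · have h0 : 0 ≤ regDelta n 1 x := by unfold regDelta; positivity
    rw [norm_mul, Real.norm_of_nonneg h0]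
    exact mul_le_mul_of_nonneg_right (hC _) h0
  · have h : Tendsto (fun i => φ (δ i • x)) atTop (𝓝 (φ 0)) := by
      have h1 : Tendsto (fun i => δ i • x) atTop (𝓝 0) := by
        simpa using hδ.smul_const x
      exact (hφ.tendsto 0).comp h1
    exact h.mul_const _

theorem integrable_pderiv_smul {m : ℕ} {φ : Pt m → ℝ} (hφ : ContDiff ℝ 1 φ)
    (hφc : HasCompactSupport φ) {F : Pt m → Cl m} (hF : LocallyIntegrable F)
    (T : Fin (m + 1) → Cl m →L[ℝ] Cl m) :
    Integrable fun x => ∑ j, pderiv j φ x • T j (F x) := by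
  refine integrable_finsetSum _ fun j _ => ?_
  have h := (T j).integrable_comp (hF.integrable_smul_left_of_hasCompactSupport
    (continuous_pderiv hφ j) (hasCompactSupport_pderiv hφc j))
  simpa using h

/-- The Cauchy kernel is a multiple of a fundamental solution. -/
theorem neg_integral_regKernel_zero {φ : Pt (2 * n + 1) → ℝ} (hφ : ContDiff ℝ 1 φ)
    (hφc : HasCompactSupport φ) (T : Fin (2 * n + 1 + 1) → Cl (2 * n + 1) →L[ℝ] Cl (2 * n + 1))
    (hT : ∀ ε x, 0 < ε → ∑ j, T j (pderiv j (regKernel n ε) x) =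
      regDelta n ε x • (1 : Cl (2 * n + 1))) :
    (-∫ x, ∑ j, pderiv j φ x • T j (regKernel n 0 x)) =
      (φ 0 * cauchyMass n) • (1 : Cl (2 * n + 1)) := by
  set δ : ℕ → ℝ := fun i => 1 / ((i : ℝ) + 1)
  have hδ : Tendsto δ atTop (𝓝 0) := tendsto_one_div_add_atTop_nhds_zero_nat
  have hpos : ∀ i, 0 < δ i := fun i => by positivity
  have h1 : ∀ i, (-∫ x, ∑ j, pderiv j φ x • T j (regKernel n (δ i) x)) =
      (∫ x, φ x * regDelta n (δ i) x) • (1 : Cl (2 * n + 1)) := by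
    intro i
    rw [neg_integral_sum_pderiv_smul hφ hφc (contDiff_regKernel (hpos i)) T,
      ← integral_smul_const]
    simp only [hT _ _ (hpos i), smul_smul]
  have h2 : Tendsto (fun i => ∫ x, ∑ j, pderiv j φ x • T j (regKernel n (δ i) x)) atTop
      (𝓝 (∫ x, ∑ j, pderiv j φ x • T j (regKernel n 0 x))) := by
    refine tendsto_integral_of_dominated_convergence
      (fun x => ∑ j, ‖pderiv j φ x‖ * (‖T j‖ * (‖conjL (2 * n + 1)‖ * (‖x‖ ^ (2 * n + 1))⁻¹)))
      (fun i => ?_) ?_ (fun i => Eventually.of_forall fun x => ?_)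
      (Eventually.of_forall fun x => ?_)
    · exact (integrable_pderiv_smul hφ hφc (locallyIntegrable_regKernel _) T).aestronglyMeasurable
    · refine integrable_finsetSum _ fun j _ => ?_
      have h := ((locallyIntegrable_norm_pow_inv (2 * n + 1)).integrable_smul_left_of_hasCompactSupport
        (continuous_pderiv hφ j) (hasCompactSupport_pderiv hφc j)).norm.const_mul
        (‖T j‖ * ‖conjL (2 * n + 1)‖)
      refine h.congr (Eventually.of_forall fun x => ?_)
      simp only [norm_smul, norm_inv, norm_pow, norm_norm]
      ring
    · refine (norm_sum_le _ _).trans (Finset.sum_le_sum fun j _ => ?_)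
      rw [norm_smul]
      gcongr
      exact ((T j).le_opNorm _).trans (by gcongr; exact norm_regKernel_le _ x)
    · refine tendsto_finsetSum _ fun j _ => ?_
      exact (((T j).continuous.tendsto _).comp (tendsto_regKernel hδ x)).const_smul _
  have h3 := (tendsto_integral_regDelta hφ.continuous hφc hδ hpos).smul_const
    (1 : Cl (2 * n + 1))
  simp only [← h1] at h3
  exact tendsto_nhds_unique h2.neg h3

/-- The monogenic part M integrates by parts to zero, and c normalizes the mass of the kernel. The
family T stands for left or right multiplication by the units, so both sides of the operator are
handled at once. -/
theorem neg_integral_eq_delta {c : ℝ} {F : Pt (2 * n + 1) → Cl (2 * n + 1)}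
    {M : Pt (2 * n + 1) → Cl (2 * n + 1)} (hM : ContDiff ℝ 1 M)
    (hF : F =ᵐ[volume] fun x => c • (regKernel n 0 x + M x)) (hc : c * cauchyMass n = 1)
    {φ : Pt (2 * n + 1) → ℝ} (hφ : ContDiff ℝ 1 φ) (hφc : HasCompactSupport φ)
    (T : Fin (2 * n + 1 + 1) → Cl (2 * n + 1) →L[ℝ] Cl (2 * n + 1))
    (hT : ∀ ε x, 0 < ε → ∑ j, T j (pderiv j (regKernel n ε) x) =
      regDelta n ε x • (1 : Cl (2 * n + 1)))
    (hTM : ∀ x, ∑ j, T j (pderiv j M x) = 0) :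
    (-∫ x, ∑ j, pderiv j φ x • T j (F x)) = algebraMap ℝ (Cl (2 * n + 1)) (φ 0) := by
  have h1 : ∫ x, ∑ j, pderiv j φ x • T j (F x) =
      ∫ x, c • ((∑ j, pderiv j φ x • T j (regKernel n 0 x)) +
        ∑ j, pderiv j φ x • T j (M x)) := by
    refine integral_congr_ae ?_
    filter_upwards [hF] with x hx
    rw [hx, ← Finset.sum_add_distrib, Finset.smul_sum]
    refine Finset.sum_congr rfl fun j _ => ?_
    rw [map_smul, map_add, ← smul_add, smul_comm]
  have h2 := neg_integral_regKernel_zero hφ hφc T hT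
  have h3 := neg_integral_sum_pderiv_smul hφ hφc hM T
  simp only [hTM, smul_zero, integral_zero] at h3
  rw [h1, integral_smul, integral_add
    (integrable_pderiv_smul hφ hφc (locallyIntegrable_regKernel 0) T)
    (integrable_pderiv_smul hφ hφc hM.continuous.locallyIntegrable T), ← smul_neg, neg_add, h2, h3,
    add_zero, smul_smul, Algebra.algebraMap_eq_smul_one]
  congr 1
  linear_combination φ 0 * hc

end

theorem exists_isFundamentalSolution_gaussFt (n : ℕ) :
    ∃ c : ℝ, c ≠ 0 ∧
      IsFundamentalSolution fun x : Pt (2 * n + 1) => c • gaussFt (2 * n + 1) x := by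
  set D : ℝ := (-1 : ℝ) ^ n * ((2 * n).doubleFactorial : ℝ) ^ 2 with hD
  have hD0 : D ≠ 0 := by
    have : ((2 * n).doubleFactorial : ℝ) ≠ 0 := by
      exact_mod_cast (Nat.doubleFactorial_pos _).ne'
    rw [hD]
    exact mul_ne_zero (pow_ne_zero _ (by norm_num)) (pow_ne_zero _ this)
  have hκ : cauchyMass n ≠ 0 := cauchyMass_pos.ne'
  have hM := contDiff_gaussMonogenic n
  obtain ⟨-, hML, hMR⟩ := isEntireTwoSidedMonogenic_gaussMonogenic n
  have hF : (fun x => ((cauchyMass n)⁻¹ * D⁻¹) • gaussFt (2 * n + 1) x) =ᵐ[volume]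
      fun x => (cauchyMass n)⁻¹ • (regKernel n 0 x + gaussMonogenic n x) := by
    -- The decomposition is known only away from the origin, which is a null set.
    filter_upwards [compl_mem_ae_iff.2 (measure_singleton (0 : Pt (2 * n + 1)))] with x hx
    rw [gaussFt_eq hx, ← hD, smul_smul, mul_assoc, inv_mul_cancel₀ hD0, mul_one, regKernel,
      conjL_apply, zero_pow two_ne_zero, add_zero, ← pow_mul]
    rfl
  refine ⟨(cauchyMass n)⁻¹ * D⁻¹, mul_ne_zero (inv_ne_zero hκ) (inv_ne_zero hD0), ?_, ?_⟩
  · exact (((locallyIntegrable_regKernel 0).add hM.continuous.locallyIntegrable).smul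
      (cauchyMass n)⁻¹).congr hF.symm
  · intro φ hφ hφc
    have hφ1 : ContDiff ℝ 1 φ := hφ.of_le (by exact_mod_cast le_top)
    constructor
    · exact neg_integral_eq_delta hM hF (inv_mul_cancel₀ hκ) hφ1 hφc
        (fun j => LinearMap.toContinuousLinearMap (LinearMap.mulLeft ℝ (unit (2 * n + 1) j)))
        (fun ε x hε => (crLeft_regKernel hε x).1) hML
    · exact neg_integral_eq_delta hM hF (inv_mul_cancel₀ hκ) hφ1 hφc
        (fun j => LinearMap.toContinuousLinearMap (LinearMap.mulRight ℝ (unit (2 * n + 1) j)))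
        (fun ε x hε => (crLeft_regKernel hε x).2) hMR

end Clifford

end

theorem proposition3 (m : ℕ) (hm : Odd m) :
    (∃ M : Clifford.Pt m → Clifford.Cl m, Clifford.IsEntireTwoSidedMonogenic M ∧
      ∀ x : Clifford.Pt m, x ≠ 0 →
        Clifford.gaussFt m x =
          ((-1 : ℝ) ^ ((m - 1) / 2) * (Nat.doubleFactorial (m - 1) : ℝ) ^ 2) •
            ((‖x‖ ^ (m + 1))⁻¹ • star (Clifford.paravector x) + M x)) ∧
    (∃ c : ℝ, c ≠ 0 ∧
      Clifford.IsFundamentalSolution fun x : Clifford.Pt m => c • Clifford.gaussFt m x) ∧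
    (∀ K R : ℝ, 0 < K → 0 < R → ∃ C : ℝ, 0 < C ∧
      ∀ x : Clifford.Pt m, |x 0| ≤ K → R ≤ ‖Clifford.vecPart x‖ →
        ‖Clifford.gaussFt m x‖ ≤ C * Real.exp (-‖Clifford.vecPart x‖ ^ 2 / 2)) := by
  obtain ⟨n, rfl⟩ := hm
  refine ⟨⟨Clifford.gaussMonogenic n, Clifford.isEntireTwoSidedMonogenic_gaussMonogenic n,
    fun x hx => ?_⟩, Clifford.exists_isFundamentalSolution_gaussFt n,
    fun K R hK hR => Clifford.gaussFt_decay n hK hR⟩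
  rw [Clifford.gaussFt_eq hx]
  simp
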